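/- Conventions. On an open set $U\subset\mathbb R^{4n}$ all tensor fields are smooth and $\Gamma$ denotes the Christoffel symbols of a Riemannian metric $g$. Let $I^1,I^2,I^3$ be integrable complex structures on $U$ that satisfy the quaternion relations $I^1I^2=-I^2I^1=I^3$ (and cyclic permutations) and for which $g$ is Hermitian. The pair $(g,I^p)$ is hyper-Kähler if $\nabla I^p=0$ for the Levi-Civita connection $\nabla$ of $g$; it is HKT with (Bismut) torsion $C$ if $C_{SPM}$ is completely antisymmetric and all $I^p$ are covariantly constant for the connection $\hat\Gamma^Q_{PM}=\Gamma^Q_{PM}+\tfrac12 g^{QS}C_{SPM}$. A vielbein of $(g,I^p)$ is a local frame $e_M^A$ with $g_{MN}=e_M^Ae_N^A$ in which the $I^p$ are the canonical constant block-diagonal quaternionic structures $\mathcal I^p$ of $\mathbb R^{4n}$, i.e. $(I^p)_M{}^N=e_M^A(\mathcal I^p)_{AB}e_B^N$. An HKT structure $(g,I^p)$ on $U$ is irreducible if there is no hyper-Kähler structure $(\tilde g,\tilde I^p)$ on $U$ whose vielbeins are, near each point, of the form $\tilde e=eR$, with $e$ a vielbein of $(g,I^p)$ and $R$ a smooth field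 of invertible real matrices commuting with the $\mathcal I^p$ (for $n=1$ such an $R$ is a positive conformal factor times an element of $Sp(1)$, which does not affect the metric). Theorem. Irreducible HKT metrics exist (on nonempty open sets $U$). Namely, let $\lambda,\rho\in\mathbb R$ with $\rho\ne0$, and consider the 4-dimensional Delduc–Valent metric $d\tau^2$, $$4\,d\tau^2=V^{-1}(d\Psi+\omega)^2+V\,\Gamma,\qquad V=\frac1s+\lambda,\qquad \omega=\cos\theta\,d\phi-\frac{\rho(1+\lambda s)}{1+\rho^2s^2}\,ds,$$ $$\Gamma=\frac{ds^2}{(1+\rho^2s^2)^2}+\frac{s^2}{1+\rho^2s^2}\,(d\theta^2+\sin^2\theta\,d\phi^2),$$ on the coordinate domain $D=\{(s,\Psi,\theta,\phi)\in\mathbb R^4: s>0,\ V(s)>0,\ 0<\theta<\pi\}$, and the 3-form $$T=\frac{\rho s(1+\lambda s)}{(1+\rho^2s^2)^2}\,ds\wedge\sin\theta\,d\theta\wedge d\phi=\tfrac1{3!}T_{SPM}\,dx^S\wedge dx^P\wedge dx^M.$$ (a) There are complex structures $I^1,I^2,I^3$ on $D$ for which $(d\tau^2,I^p)$ is HKT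 with torsion $C=\tfrac12T$. (b) Let $U\subset D$ be nonempty and open, and let $I^1,I^2,I^3$ be any complex structures on $U$ for which $(d\tau^2,I^p)$ is HKT with torsion $cT$, where $c\ne0$ is a real constant. Then $(d\tau^2,I^p)$ is irreducible on $U$, and there is no smooth real function $G>0$ on $U$ such that $I^1,I^2,I^3$ are covariantly constant with respect to the Levi-Civita connection of $G\,d\tau^2$. -/

import Mathlib

open scoped ContDiff Kronecker

noncomputable section

namespace HKT

/-! Tensor calculus on open subsets of the coordinate space `ι → ℝ`.
A matrix field `T : (ι → ℝ) → Matrix ι ι ℝ` stands for the components of a tensor field of rank two: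
`g x M N` is `g_{MN}(x)`, and for a complex structure `I x M N` is `I_M^N(x)`
(the row is the lower index, so that the matrix product is `I_M^N J_N^K`). -/

variable {ι : Type*} [Fintype ι] [DecidableEq ι]

/-- The partial derivative `∂_M f` at `x`. -/
def pd (M : ι) (f : (ι → ℝ) → ℝ) (x : ι → ℝ) : ℝ :=
  fderiv ℝ f x (Pi.single M 1)

/-- All the entries of a matrix-valued function are `C^∞` on `U`. -/
def SmoothOn {α β : Type*} (U : Set (ι → ℝ)) (T : (ι → ℝ) → Matrix α β ℝ) : Prop :=
  ∀ a b, ContDiffOn ℝ ∞ (fun x => T x a b) U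

/-- `g` is a (smooth, positive definite) Riemannian metric on the open set `U`. -/
structure IsMetric (U : Set (ι → ℝ)) (g : (ι → ℝ) → Matrix ι ι ℝ) : Prop where
  isOpen : IsOpen U
  smooth : SmoothOn U g
  posDef : ∀ x ∈ U, (g x).PosDef

/-- The coefficients of an affine connection: `Γ x Q P M` is `Γ^Q_{PM}(x)`,
where `P` is the direction of differentiation. -/
abbrev Connection (ι : Type*) := (ι → ℝ) → ι → ι → ι → ℝ

/-- The Christoffel symbols
`Γ^Q_{PM} = ½ g^{QS} (∂_P g_{SM} + ∂_M g_{SP} - ∂_S g_{PM})`. -/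
def leviCivita (g : (ι → ℝ) → Matrix ι ι ℝ) : Connection ι := fun x Q P M =>
  (1 / 2) * ∑ S, (g x)⁻¹ Q S *
    (pd P (fun y => g y S M) x + pd M (fun y => g y S P) x - pd S (fun y => g y P M) x)

/-- The connection `Γ^Q_{PM} + ½ g^{QS} C_{SPM}`, with `C x S P M` for `C_{SPM}(x)`. -/
def torsionConnection (g : (ι → ℝ) → Matrix ι ι ℝ) (C : (ι → ℝ) → ι → ι → ι → ℝ) :
    Connection ι := fun x Q P M =>
  leviCivita g x Q P M + (1 / 2) * ∑ S, (g x)⁻¹ Q S * C x S P M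

/-- The covariant derivative `∇_P I_M^N = ∂_P I_M^N - Γ^Q_{PM} I_Q^N + Γ^N_{PQ} I_M^Q`. -/
def covDeriv (Γ : Connection ι) (I : (ι → ℝ) → Matrix ι ι ℝ) (x : ι → ℝ) (P M N : ι) : ℝ :=
  pd P (fun y => I y M N) x - ∑ Q, Γ x Q P M * I x Q N + ∑ Q, Γ x N P Q * I x M Q

/-- `I` is covariantly constant on `U` with respect to `Γ`. -/
def IsParallel (U : Set (ι → ℝ)) (Γ : Connection ι) (I : (ι → ℝ) → Matrix ι ι ℝ) : Prop :=
  ∀ x ∈ U, ∀ P M N, covDeriv Γ I x P M N = 0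

/-- `I` is an integrable complex structure on `U`. -/
structure IsComplexStructure (U : Set (ι → ℝ)) (I : (ι → ℝ) → Matrix ι ι ℝ) : Prop where
  smooth : SmoothOn U I
  sq : ∀ x ∈ U, I x * I x = -1
  integrable : ∀ x ∈ U, ∀ M N P,
    pd M (fun y => I y N P) x - pd N (fun y => I y M P) x =
      ∑ Q, ∑ S, I x M Q * I x N S * (pd Q (fun y => I y S P) x - pd S (fun y => I y Q P) x)

/-- The metric is Hermitian with respect to `I`: `I_P^M g_{MQ} I_N^Q = g_{PN}`. -/
def IsHermitianFor (U : Set (ι → ℝ)) (g I : (ι → ℝ) → Matrix ι ι ℝ) : Prop :=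
  ∀ x ∈ U, I x * g x * (I x).transpose = g x

/-- Three integrable complex structures on `U` that satisfy the quaternion algebra
and with respect to which the metric `g` on `U` is Hermitian. -/
structure IsHyperHermitian (U : Set (ι → ℝ)) (g : (ι → ℝ) → Matrix ι ι ℝ)
    (I : Fin 3 → (ι → ℝ) → Matrix ι ι ℝ) : Prop where
  metric : IsMetric U g
  complex : ∀ p, IsComplexStructure U (I p)
  hermitian : ∀ p, IsHermitianFor U g (I p)
  mul01 : ∀ x ∈ U, I 0 x * I 1 x = I 2 x ∧ I 1 x * I 0 x = -I 2 x
  mul12 : ∀ x ∈ U, I 1 x * I 2 x = I 0 x ∧ I 2 x * I 1 x = -I 0 x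
  mul20 : ∀ x ∈ U, I 2 x * I 0 x = I 1 x ∧ I 0 x * I 2 x = -I 1 x

/-- `(g, I)` is hyper-Kähler on `U`: the three quaternionic complex structures are covariantly
constant with respect to the Levi-Civita connection. -/
structure IsHyperKahler (U : Set (ι → ℝ)) (g : (ι → ℝ) → Matrix ι ι ℝ)
    (I : Fin 3 → (ι → ℝ) → Matrix ι ι ℝ) : Prop where
  hyperHermitian : IsHyperHermitian U g I
  parallel : ∀ p, IsParallel U (leviCivita g) (I p)

/-- `(g, I)` is HKT on `U`, the torsion of the Bismut connection being `C`: the tensor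
`C_{SPM}` is completely antisymmetric, and the three quaternionic complex structures are
covariantly constant with respect to the connection `Γ^Q_{PM} + ½ g^{QS} C_{SPM}`. -/
structure IsHKTWithTorsion (U : Set (ι → ℝ)) (g : (ι → ℝ) → Matrix ι ι ℝ)
    (I : Fin 3 → (ι → ℝ) → Matrix ι ι ℝ) (C : (ι → ℝ) → ι → ι → ι → ℝ) : Prop where
  hyperHermitian : IsHyperHermitian U g I
  smooth : ∀ S P M, ContDiffOn ℝ ∞ (fun x => C x S P M) U
  antisymm_left : ∀ x ∈ U, ∀ S P M, C x P S M = -C x S P M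
  antisymm_right : ∀ x ∈ U, ∀ S P M, C x S M P = -C x S P M
  parallel : ∀ p, IsParallel U (torsionConnection g C) (I p)

/-- `(g, I)` is HKT on `U`. -/
def IsHKT (U : Set (ι → ℝ)) (g : (ι → ℝ) → Matrix ι ι ℝ)
    (I : Fin 3 → (ι → ℝ) → Matrix ι ι ℝ) : Prop :=
  ∃ C, IsHKTWithTorsion U g I C

/-- The three canonical quaternionic complex structures on `ℝ⁴`. -/
def canon : Fin 3 → Matrix (Fin 4) (Fin 4) ℝ := ![
  !![0, 0, 0, 1; 0, 0, 1, 0; 0, -1, 0, 0; -1, 0, 0, 0],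
  !![0, 0, 1, 0; 0, 0, 0, -1; -1, 0, 0, 0; 0, 1, 0, 0],
  !![0, 1, 0, 0; -1, 0, 0, 0; 0, 0, 0, 1; 0, 0, -1, 0]]

/-- The canonical complex structures `diag (canon p, …, canon p)` in the tangent space `ℝ^{4n}`. -/
def flatStructure (n : ℕ) (p : Fin 3) : Matrix (Fin n × Fin 4) (Fin n × Fin 4) ℝ :=
  (1 : Matrix (Fin n) (Fin n) ℝ) ⊗ₖ canon p

/-- `e` (with components `e_M^A`) is a vielbein on `V` for the metric `g`, `g_{MN} = e_M^A e_N^A`,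
in which the complex structures have the canonical form,
`I_M^N = e_M^A (flatStructure)_{AB} e^N_B`. -/
structure IsVielbein (n : ℕ) (V : Set (ι → ℝ)) (g : (ι → ℝ) → Matrix ι ι ℝ)
    (I : Fin 3 → (ι → ℝ) → Matrix ι ι ℝ)
    (e : (ι → ℝ) → Matrix ι (Fin n × Fin 4) ℝ) : Prop where
  smooth : SmoothOn V e
  metric : ∀ x ∈ V, e x * (e x).transpose = g x
  structures : ∀ p, ∀ x ∈ V, I p x * e x = e x * flatStructure n p

/-- `R` is a smooth field of invertible real matrices on `V` that commute with the canonical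
complex structures. In the spinor notation, where the tangent space index is a pair `(j, a)` and the
canonical structures act as Pauli matrices on `j`, these are precisely the pseudoreal
matrices `R_b^a` that act on the symplectic index `a` only. -/
structure IsVielbeinTransformation (n : ℕ) (V : Set (ι → ℝ))
    (R : (ι → ℝ) → Matrix (Fin n × Fin 4) (Fin n × Fin 4) ℝ) : Prop where
  smooth : SmoothOn V R
  isUnit_det : ∀ x ∈ V, IsUnit (R x).det
  comm : ∀ p, ∀ x ∈ V, R x * flatStructure n p = flatStructure n p * R x

/-- `(g, I)` and `(g', I')` are related by a transformation `e → e R` of the vielbeins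
(a vielbein is a local object, and is only required to exist near each point). -/
def VielbeinRelated (n : ℕ) (U : Set (ι → ℝ))
    (g : (ι → ℝ) → Matrix ι ι ℝ) (I : Fin 3 → (ι → ℝ) → Matrix ι ι ℝ)
    (g' : (ι → ℝ) → Matrix ι ι ℝ) (I' : Fin 3 → (ι → ℝ) → Matrix ι ι ℝ) : Prop :=
  ∀ x ∈ U, ∃ V, IsOpen V ∧ x ∈ V ∧ V ⊆ U ∧ ∃ e R, IsVielbeinTransformation n V R ∧
    IsVielbein n V g I e ∧ IsVielbein n V g' I' (fun y => e y * R y)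

/-- `(g, I)` is an irreducible HKT structure on `U`, of real dimension `4 n`: it is HKT, and it is
not related to any hyper-Kähler structure on `U` by a transformation of the vielbeins. -/
structure IsIrreducibleHKT (n : ℕ) (U : Set (ι → ℝ)) (g : (ι → ℝ) → Matrix ι ι ℝ)
    (I : Fin 3 → (ι → ℝ) → Matrix ι ι ℝ) : Prop where
  card_eq : Fintype.card ι = 4 * n
  hkt : IsHKT U g I
  irreducible : ¬ ∃ g' I', IsHyperKahler U g' I' ∧ VielbeinRelated n U g I g' I'

/-! The Delduc-Valent metric, in the coordinates
`x 0 = s`, `x 1 = Ψ`, `x 2 = θ`, `x 3 = φ`. -/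

/-- The coordinate domain `s > 0`, `V(s) > 0`, `0 < θ < π`. -/
def dvDomain (lam : ℝ) : Set (Fin 4 → ℝ) :=
  {x | 0 < x 0 ∧ 0 < 1 / x 0 + lam ∧ 0 < x 2 ∧ x 2 < Real.pi}

/-- The potential `V(s) = 1 / s + λ`. -/
def dvV (lam : ℝ) (x : Fin 4 → ℝ) : ℝ := 1 / x 0 + lam

/-- The components of the 1-form
`dΨ + ω`, where `ω = cos θ dφ - ρ (1 + λ s) / (1 + ρ² s²) ds`. -/
def dvForm (lam rho : ℝ) (x : Fin 4 → ℝ) : Fin 4 → ℝ :=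
  ![-(rho * (1 + lam * x 0) / (1 + rho ^ 2 * x 0 ^ 2)), 1, 0, Real.cos (x 2)]

/-- The components of the 3-dimensional metric
`Γ = ds² / (1 + ρ² s²)² + s² / (1 + ρ² s²) (dθ² + sin² θ dφ²)`. -/
def dvGamma (rho : ℝ) (x : Fin 4 → ℝ) : Matrix (Fin 4) (Fin 4) ℝ :=
  Matrix.diagonal ![1 / (1 + rho ^ 2 * x 0 ^ 2) ^ 2, 0,
    x 0 ^ 2 / (1 + rho ^ 2 * x 0 ^ 2), x 0 ^ 2 / (1 + rho ^ 2 * x 0 ^ 2) * Real.sin (x 2) ^ 2]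

/-- The metric `dτ²` with `4 dτ² = V⁻¹ (dΨ + ω)² + V Γ`. -/
def dvMetric (lam rho : ℝ) (x : Fin 4 → ℝ) : Matrix (Fin 4) (Fin 4) ℝ :=
  (1 / 4 : ℝ) • ((dvV lam x)⁻¹ • Matrix.vecMulVec (dvForm lam rho x) (dvForm lam rho x) +
    dvV lam x • dvGamma rho x)

/-- The components `T_{SPM}` of the 3-form
`ρ s (1 + λ s) / (1 + ρ² s²)² ds ∧ sin θ dθ ∧ dφ = (1 / 3!) T_{SPM} dx^S ∧ dx^P ∧ dx^M`. -/
def dvTorsion (lam rho : ℝ) (x : Fin 4 → ℝ) (S P M : Fin 4) : ℝ :=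
  rho * x 0 * (1 + lam * x 0) / (1 + rho ^ 2 * x 0 ^ 2) ^ 2 * Real.sin (x 2) *
    Matrix.det (Matrix.of fun i j : Fin 3 =>
      if (![S, P, M] : Fin 3 → Fin 4) i = (![0, 2, 3] : Fin 3 → Fin 4) j then (1 : ℝ) else 0)

end HKT

end

/-! Obstruction. If a conformal rescaling `G g` of an HKT metric makes the same `I^p` Levi-Civita
parallel, the difference of its Levi-Civita connection and the Bismut connection is, in each
direction, a matrix commuting with all three `I^p`. Each `I^p` is a product of two anticommuting
ones, so that matrix has zero trace against `I^p`. Written out, this expresses `I^p dG` through the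
contraction of the torsion with `g⁻¹ I^p` (`IsHKTWithTorsion.mulVec_pd`).

For the Delduc–Valent metric the torsion has no `dΨ` leg, so every `I^p dG` vanishes on `∂_Ψ`. Since
`∂_Ψ` and its three quaternionic images span the tangent space (`quaternionic_span`), `dG` is a
multiple of the metric dual of `∂_Ψ`, that is, of `η = dΨ + ω`. The multiple is nonzero, for
otherwise the torsion contractions would make an invertible antisymmetric matrix singular
(`pd_conformal_factor`). But `η ∧ dη ≠ 0` because of the term `cos θ dφ`, so no nonzero multiple of
`η` is exact (`not_exists_conformal_factor`). Irreducibility reduces to this statement: in dimension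
four a vielbein change commuting with the quaternions is itself a quaternion, hence conformal, and
it keeps the `I^p` (`VielbeinRelated.exists_conformal_factor`).

Existence. The metric `Γ` is the round 3-sphere of radius `1/|ρ|`; its left-invariant coframe
satisfies `dσ = ρ σ × σ`, and `V` and `η` solve the monopole equation `dη = *dV` on it. As in the
Gibbons–Hawking construction, the frame built from `η/√V` and `√V σ` has anti-self-dual connection
coefficients, now with torsion proportional to `e¹ ∧ e² ∧ e³` (`monopoleFrame_structure`). Such
coefficients commute with the constant quaternionic structures of the frame, which are therefore
parallel, and integrable since the torsion is a 3-form (`isHKTWithTorsion_of_frame`). -/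

namespace HKT

/-! ### Partial derivatives of functions and matrix fields. -/

section Calculus

variable {ι : Type*}

lemma differentiableAt_of_contDiffOn [Fintype ι] {f : (ι → ℝ) → ℝ} {U : Set (ι → ℝ)} (hU : IsOpen U)
    {x : ι → ℝ} (hx : x ∈ U) (hf : ContDiffOn ℝ ∞ f U) : DifferentiableAt ℝ f x :=
  (hf.contDiffAt (hU.mem_nhds hx)).differentiableAt (by simp)

variable [DecidableEq ι]

lemma pd_const (M : ι) (x : ι → ℝ) (c : ℝ) : pd M (fun _ : ι → ℝ => c) x = 0 := by
  simp [pd]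

lemma pd_coord (M N : ι) (x : ι → ℝ) :
    pd M (fun y => y N) x = if M = N then 1 else 0 := by
  have : HasFDerivAt (fun y : ι → ℝ => y N) (ContinuousLinearMap.proj N : (ι → ℝ) →L[ℝ] ℝ) x :=
    hasFDerivAt_apply N x
  simp [pd, this.fderiv, Pi.single_apply, eq_comm]

lemma pd_congr {M : ι} {f k : (ι → ℝ) → ℝ} {U : Set (ι → ℝ)} (hU : IsOpen U) {x : ι → ℝ}
    (hx : x ∈ U) (h : ∀ y ∈ U, f y = k y) : pd M f x = pd M k x := by
  have : f =ᶠ[nhds x] k := Filter.eventuallyEq_of_mem (hU.mem_nhds hx) h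
  simp [pd, this.fderiv_eq]

/-- The entrywise partial derivative of a matrix field. -/
noncomputable def matPd {α β : Type*} (P : ι) (A : (ι → ℝ) → Matrix α β ℝ) (x : ι → ℝ) :
    Matrix α β ℝ :=
  Matrix.of fun a b => pd P (fun y => A y a b) x

lemma matPd_congr {α β : Type*} {P : ι} {A B : (ι → ℝ) → Matrix α β ℝ} {U : Set (ι → ℝ)}
    (hU : IsOpen U) {x : ι → ℝ} (hx : x ∈ U) (h : ∀ y ∈ U, A y = B y) :
    matPd P A x = matPd P B x := by
  ext a b
  exact pd_congr hU hx fun y hy => by rw [h y hy]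

variable [Fintype ι]

lemma pd_neg {M : ι} {f : (ι → ℝ) → ℝ} {x : ι → ℝ} :
    pd M (fun y => -f y) x = -pd M f x := by
  simp [pd, fderiv_fun_neg]

lemma pd_mul {M : ι} {f k : (ι → ℝ) → ℝ} {x : ι → ℝ} (hf : DifferentiableAt ℝ f x)
    (hk : DifferentiableAt ℝ k x) :
    pd M (fun y => f y * k y) x = pd M f x * k x + f x * pd M k x := by
  simp [pd, fderiv_fun_mul hf hk]; ring

lemma pd_const_mul {M : ι} {f : (ι → ℝ) → ℝ} {x : ι → ℝ} (c : ℝ) (hf : DifferentiableAt ℝ f x) :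
    pd M (fun y => c * f y) x = c * pd M f x := by
  simp [pd, fderiv_const_mul hf]

lemma pd_sum {κ : Type*} (s : Finset κ) {M : ι} {f : κ → (ι → ℝ) → ℝ} {x : ι → ℝ}
    (hf : ∀ i ∈ s, DifferentiableAt ℝ (f i) x) :
    pd M (fun y => ∑ i ∈ s, f i y) x = ∑ i ∈ s, pd M (f i) x := by
  simp [pd, fderiv_fun_sum hf]

lemma pd_comp {M : ι} {φ : ℝ → ℝ} {φ' : ℝ} {f : (ι → ℝ) → ℝ} {x : ι → ℝ}
    (hφ : HasDerivAt φ φ' (f x)) (hf : DifferentiableAt ℝ f x) :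
    pd M (fun y => φ (f y)) x = φ' * pd M f x := by
  have h := (hφ.comp_hasFDerivAt x hf.hasFDerivAt).fderiv
  simp only [pd]
  rw [show (fun y => φ (f y)) = φ ∘ f from rfl, h]
  simp

lemma differentiableAt_pd {f : (ι → ℝ) → ℝ} {x : ι → ℝ} (hf : ContDiffAt ℝ ∞ f x) (M : ι) :
    DifferentiableAt ℝ (pd M f) x := by
  have h : ContDiffAt ℝ 1 (fderiv ℝ f) x := hf.fderiv_right (by norm_cast)
  exact (h.differentiableAt (by simp)).clm_apply (differentiableAt_const _)

lemma pd_comm {f : (ι → ℝ) → ℝ} {x : ι → ℝ} (hf : ContDiffAt ℝ ∞ f x) (M N : ι) :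
    pd M (pd N f) x = pd N (pd M f) x := by
  have h : ContDiffAt ℝ 1 (fderiv ℝ f) x := hf.fderiv_right (by norm_cast)
  have hd := h.differentiableAt (by simp)
  have key : ∀ K L : ι, pd K (pd L f) x =
      fderiv ℝ (fderiv ℝ f) x (Pi.single K 1) (Pi.single L 1) := by
    intro K L
    change fderiv ℝ (fun y => fderiv ℝ f y (Pi.single L 1)) x (Pi.single K 1) = _
    rw [fderiv_clm_apply hd (differentiableAt_const _)]
    simp
  rw [key, key]
  exact (hf.isSymmSndFDerivAt (by simp; norm_cast)).eq _ _

lemma matPd_mul {α β γ : Type*} [Fintype β] (P : ι) {A : (ι → ℝ) → Matrix α β ℝ}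
    {B : (ι → ℝ) → Matrix β γ ℝ} {x : ι → ℝ}
    (hA : ∀ a b, DifferentiableAt ℝ (fun y => A y a b) x)
    (hB : ∀ a b, DifferentiableAt ℝ (fun y => B y a b) x) :
    matPd P (fun y => A y * B y) x = matPd P A x * B x + A x * matPd P B x := by
  ext a c
  simp only [matPd, Matrix.of_apply, Matrix.mul_apply, Matrix.add_apply]
  rw [pd_sum (f := fun i y => A y a i * B y i c) _ fun i _ => (hA a i).mul (hB i c),
    ← Finset.sum_add_distrib]
  exact Finset.sum_congr rfl fun i _ => pd_mul (hA a i) (hB i c)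

/-- The matrix of the coefficients of a connection in the direction `P`. -/
def connMatrix (Γ : Connection ι) (x : ι → ℝ) (P : ι) : Matrix ι ι ℝ :=
  Matrix.of fun M Q => Γ x Q P M

/-- With lower indices as rows, the covariant derivative is `∂I` minus a commutator with the
connection matrix, so parallelism can be handled by matrix algebra. -/
lemma covDeriv_eq (Γ : Connection ι) (I : (ι → ℝ) → Matrix ι ι ℝ) (x : ι → ℝ) (P M N : ι) :
    covDeriv Γ I x P M N =
      (matPd P I x - connMatrix Γ x P * I x + I x * connMatrix Γ x P) M N := by
  simp [covDeriv, matPd, connMatrix, Matrix.mul_apply, mul_comm]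

lemma leviCivita_congr {g g' : (ι → ℝ) → Matrix ι ι ℝ} {U : Set (ι → ℝ)} (hU : IsOpen U)
    (h : ∀ y ∈ U, g y = g' y) {x : ι → ℝ} (hx : x ∈ U) (Q P M : ι) :
    leviCivita g x Q P M = leviCivita g' x Q P M := by
  have key : ∀ K A B, pd K (fun y => g y A B) x = pd K (fun y => g' y A B) x :=
    fun K A B => pd_congr hU hx fun y hy => by rw [h y hy]
  simp only [leviCivita, key, h x hx]

lemma IsParallel.congr {g g' I I' : (ι → ℝ) → Matrix ι ι ℝ} {U : Set (ι → ℝ)} (hU : IsOpen U)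
    (hg : ∀ y ∈ U, g y = g' y) (hI : ∀ y ∈ U, I y = I' y)
    (h : IsParallel U (leviCivita g) I) : IsParallel U (leviCivita g') I' := by
  intro x hx P M N
  rw [← h x hx P M N]
  simp only [covDeriv, leviCivita_congr hU hg hx, hI x hx]
  rw [pd_congr (f := fun y => I' y M N) (k := fun y => I y M N) hU hx fun y hy => by rw [hI y hy]]

end Calculus

/-! ### Consequences of a conformal factor that makes the complex structures parallel. -/

section Obstruction

variable {ι : Type*} [Fintype ι]

/-- Moving `I` past `D` and around the trace exchanges `I` and `J`, while anticommutation changes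
the sign; the trace is therefore its own negative. -/
lemma trace_mul_eq_zero_of_anticomm {D I J : Matrix ι ι ℝ} (hI : D * I = I * D)
    (h : I * J = -(J * I)) : (D * (I * J)).trace = 0 := by
  have h1 : (D * (I * J)).trace = (D * (J * I)).trace := by
    rw [← mul_assoc, hI, mul_assoc, Matrix.trace_mul_comm, mul_assoc]
  have h2 : (D * (I * J)).trace = -(D * (J * I)).trace := by
    rw [h, mul_neg, Matrix.trace_neg]
  linarith

variable [DecidableEq ι]

lemma leviCivita_smul {U : Set (ι → ℝ)} {g : (ι → ℝ) → Matrix ι ι ℝ} (hg : IsMetric U g)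
    {G : (ι → ℝ) → ℝ} {x : ι → ℝ} (hx : x ∈ U) (hG : DifferentiableAt ℝ G x) (hG0 : G x ≠ 0)
    (Q P M : ι) :
    leviCivita (fun y => G y • g y) x Q P M = leviCivita g x Q P M +
      (2 * G x)⁻¹ * ∑ S, (g x)⁻¹ Q S *
        (pd P G x * g x S M + pd M G x * g x S P - pd S G x * g x P M) := by
  have hd : ∀ A B, DifferentiableAt ℝ (fun y => g y A B) x := fun A B =>
    differentiableAt_of_contDiffOn hg.isOpen hx (hg.smooth A B)
  have hp : ∀ K A B, pd K (fun y => G y * g y A B) x =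
      pd K G x * g x A B + G x * pd K (fun y => g y A B) x :=
    fun K A B => pd_mul hG (hd A B)
  have hdet : IsUnit (g x).det := (hg.posDef x hx).det_pos.ne'.isUnit
  have hinv : (G x • g x)⁻¹ = (G x)⁻¹ • (g x)⁻¹ := by
    have := Matrix.inv_smul' (A := g x) (Units.mk0 (G x) hG0) hdet
    simpa [Units.smul_def] using this
  simp only [leviCivita, hinv, Matrix.smul_apply, smul_eq_mul, hp]
  rw [Finset.mul_sum, Finset.mul_sum, Finset.mul_sum, ← Finset.sum_add_distrib]
  refine Finset.sum_congr rfl fun S _ => ?_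
  field_simp
  ring

/-- A covector field `v` for which a conformal rescaling of `g` makes the complex structures of an
HKT structure parallel satisfies `2 I v = G ⟨C, g⁻¹ I⟩`. -/
lemma IsHKTWithTorsion.mulVec_pd {U : Set (ι → ℝ)} {g : (ι → ℝ) → Matrix ι ι ℝ}
    {I : Fin 3 → (ι → ℝ) → Matrix ι ι ℝ} {C : (ι → ℝ) → ι → ι → ι → ℝ}
    (h : IsHKTWithTorsion U g I C) {G : (ι → ℝ) → ℝ} {x : ι → ℝ} (hx : x ∈ U)
    (hG : DifferentiableAt ℝ G x) (hG0 : G x ≠ 0)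
    (hpar : ∀ p, IsParallel U (leviCivita fun y => G y • g y) (I p)) (p : Fin 3) (P : ι) :
    2 * (I p x).mulVec (fun M => pd M G x) P =
      G x * ∑ S, ∑ M, C x S P M * ((g x)⁻¹ * I p x) S M := by
  have hh := h.hyperHermitian
  set v : ι → ℝ := fun M => pd M G x with hv
  have hdet : IsUnit (g x).det := (hh.metric.posDef x hx).det_pos.ne'.isUnit
  have hsym : (g x).transpose = g x := (hh.metric.posDef x hx).isHermitian
  have hisym : ((g x)⁻¹).transpose = (g x)⁻¹ := by rw [Matrix.transpose_nonsing_inv, hsym]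
  -- Both connections preserve every `I q`, so the derivative terms cancel and `D` commutes with
  -- them.
  set D : Matrix ι ι ℝ := connMatrix (leviCivita fun y => G y • g y) x P -
    connMatrix (torsionConnection g C) x P with hD
  have hcomm : ∀ q, D * I q x = I q x * D := by
    intro q
    have h1 : ∀ M N, _ := fun M N => (covDeriv_eq _ (I q) x P M N).symm.trans (hpar q x hx P M N)
    have h2 : ∀ M N, _ := fun M N => (covDeriv_eq _ (I q) x P M N).symm.trans
      (h.parallel q x hx P M N)
    ext M N
    have h3 := h1 M N
    have h4 := h2 M N
    simp only [hD, sub_mul, mul_sub, Matrix.sub_apply, Matrix.add_apply] at h3 h4 ⊢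
    linarith
  obtain ⟨h01, h10⟩ := hh.mul01 x hx
  obtain ⟨h12, h21⟩ := hh.mul12 x hx
  obtain ⟨h20, h02⟩ := hh.mul20 x hx
  have htr : ∀ E : Matrix ι ι ℝ, (∀ q, E * I q x = I q x * E) → (E * I p x).trace = 0 := by
    intro E hE
    fin_cases p
    · simpa [h12] using trace_mul_eq_zero_of_anticomm (hE 1)
        (show I 1 x * I 2 x = _ by rw [h21, h12, neg_neg])
    · simpa [h20] using trace_mul_eq_zero_of_anticomm (hE 2)
        (show I 2 x * I 0 x = _ by rw [h02, h20, neg_neg])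
    · simpa [h01] using trace_mul_eq_zero_of_anticomm (hE 0)
        (show I 0 x * I 1 x = _ by rw [h10, h01, neg_neg])
  have ht1 : (I p x).trace = 0 := by simpa using htr 1 (by simp)
  -- The first three terms are the conformal change of the Christoffel symbols, the last is the
  -- torsion. Against `I p` the identity term has trace zero, and the two rank-one terms contribute
  -- equally because `g⁻¹ I p` is antisymmetric.
  have hD2 : (2 * G x) • D = v P • (1 : Matrix ι ι ℝ) + Matrix.vecMulVec v (Pi.single P 1) -
      Matrix.vecMulVec (g x P) ((g x)⁻¹.mulVec v) -
      G x • ((Matrix.of fun M S => C x S P M) * (g x)⁻¹) := by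
    ext M Q
    have hone : ∀ N, ∑ S, (g x)⁻¹ Q S * g x S N = (1 : Matrix ι ι ℝ) Q N := fun N => by
      rw [← Matrix.nonsing_inv_mul _ hdet, Matrix.mul_apply]
    have hCsum : ((Matrix.of fun M S => C x S P M) * (g x)⁻¹) M Q =
        ∑ S, (g x)⁻¹ Q S * C x S P M := by
      rw [Matrix.mul_apply]
      refine Finset.sum_congr rfl fun S _ => ?_
      rw [← Matrix.transpose_apply (g x)⁻¹ Q S, hisym]
      simp [mul_comm]
    simp only [hD, connMatrix, Matrix.smul_apply, Matrix.sub_apply, Matrix.add_apply, smul_eq_mul,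
      Matrix.vecMulVec_apply, torsionConnection, leviCivita_smul hh.metric hx hG hG0,
      Matrix.of_apply, hCsum]
    have hexp : ∑ S, (g x)⁻¹ Q S * (pd P G x * g x S M + pd M G x * g x S P - pd S G x * g x P M) =
        v P * (1 : Matrix ι ι ℝ) M Q + v M * (Pi.single P 1 : ι → ℝ) Q -
          g x P M * (g x)⁻¹.mulVec v Q := by
      have e1 : v P * (1 : Matrix ι ι ℝ) M Q = ∑ S, v P * ((g x)⁻¹ Q S * g x S M) := by
        rw [← Finset.mul_sum, hone, Matrix.one_apply, Matrix.one_apply]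
        simp only [eq_comm]
      have e2 : v M * (Pi.single P 1 : ι → ℝ) Q = ∑ S, v M * ((g x)⁻¹ Q S * g x S P) := by
        rw [← Finset.mul_sum, hone, Matrix.one_apply, Pi.single_apply]
      rw [e1, e2, Matrix.mulVec, dotProduct, Finset.mul_sum, ← Finset.sum_add_distrib,
        ← Finset.sum_sub_distrib]
      exact Finset.sum_congr rfl fun S _ => by simp only [hv]; ring
    rw [hexp]
    field_simp
    ring
  have hgI : (g x) * (I p x).transpose = -(I p x * g x) := by
    have h1 := hh.hermitian p x hx
    have h2 := congrArg (I p x * ·) h1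
    simp only [← mul_assoc] at h2
    rw [(hh.complex p).sq x hx] at h2
    simp only [neg_mul, one_mul] at h2
    rw [← h2, neg_neg]
  have hmain : ((2 * G x) • D * I p x).trace = 0 := by
    rw [smul_mul_assoc, Matrix.trace_smul, htr D hcomm, smul_zero]
  rw [hD2] at hmain
  simp only [sub_mul, add_mul, Matrix.trace_sub, Matrix.trace_add, smul_mul_assoc, one_mul,
    Matrix.trace_smul, ht1, Matrix.vecMulVec_mul, Matrix.trace_vecMulVec] at hmain
  have e1 : v ⬝ᵥ (Matrix.vecMul (Pi.single P 1) (I p x)) = (I p x).mulVec v P := by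
    rw [Matrix.single_one_vecMul, dotProduct_comm]; rfl
  have e2 : g x P ⬝ᵥ Matrix.vecMul ((g x)⁻¹.mulVec v) (I p x) = -(I p x).mulVec v P := by
    have : g x P ⬝ᵥ Matrix.vecMul ((g x)⁻¹.mulVec v) (I p x) =
        ((g x) * (I p x).transpose).mulVec ((g x)⁻¹.mulVec v) P := by
      rw [← Matrix.mulVec_mulVec, Matrix.mulVec_transpose]; rfl
    rw [this, hgI, Matrix.neg_mulVec, Matrix.mulVec_mulVec, mul_assoc,
      Matrix.mul_nonsing_inv _ hdet, mul_one]
    rfl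
  have e3 : ((Matrix.of fun M S => C x S P M) * (g x)⁻¹ * I p x).trace =
      ∑ S, ∑ M, C x S P M * ((g x)⁻¹ * I p x) S M := by
    rw [mul_assoc, Matrix.trace, Finset.sum_comm]
    refine Finset.sum_congr rfl fun M _ => ?_
    simp [Matrix.mul_apply]
  rw [e1, e2, e3] at hmain
  simp only [smul_eq_mul] at hmain
  linarith

/-- In dimension four a covector orthogonal to a nonzero row and to its images under the three
complex structures vanishes. -/
lemma quaternionic_span {g : Matrix (Fin 4) (Fin 4) ℝ} (hg : g.PosDef)
    {I : Fin 3 → Matrix (Fin 4) (Fin 4) ℝ} (hsq : ∀ p, I p * I p = -1)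
    (hherm : ∀ p, I p * g * (I p).transpose = g)
    (h01 : I 0 * I 1 = I 2) (h12 : I 1 * I 2 = I 0) (h20 : I 2 * I 0 = I 1)
    {r v : Fin 4 → ℝ} (hr : r ≠ 0) (hv : ∀ p, r ⬝ᵥ (I p).mulVec v = 0) :
    (r ⬝ᵥ g.mulVec r) • v = (r ⬝ᵥ v) • g.mulVec r := by
  have hgI : ∀ p, g * (I p).transpose = -(I p * g) := by
    intro p
    have h2 := congrArg (I p * ·) (hherm p)
    simp only [← mul_assoc] at h2
    rw [hsq p] at h2
    simp only [neg_mul, one_mul] at h2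
    rw [← h2, neg_neg]
  have hsym : g.transpose = g := hg.isHermitian
  set w := (r ⬝ᵥ g.mulVec r) • v - (r ⬝ᵥ v) • g.mulVec r with hw
  have hbil : ∀ a b : Fin 4 → ℝ, a ⬝ᵥ g.mulVec b = b ⬝ᵥ g.mulVec a := by
    intro a b
    rw [Matrix.dotProduct_mulVec, dotProduct_comm, ← Matrix.mulVec_transpose, hsym]
  have hI0 : ∀ p, r ⬝ᵥ (I p).mulVec (g.mulVec r) = 0 := by
    intro p
    have h1 : r ⬝ᵥ (g * (I p).transpose).mulVec r = r ⬝ᵥ (I p).mulVec (g.mulVec r) := by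
      rw [← Matrix.mulVec_mulVec, hbil, Matrix.mulVec_transpose, ← Matrix.dotProduct_mulVec]
    rw [hgI p, Matrix.neg_mulVec, dotProduct_neg, ← Matrix.mulVec_mulVec] at h1
    linarith
  have hw0 : r ⬝ᵥ w = 0 := by
    simp only [hw, dotProduct_sub, dotProduct_smul, smul_eq_mul]; ring
  have hwp : ∀ p, r ⬝ᵥ (I p).mulVec w = 0 := by
    intro p
    simp only [hw, Matrix.mulVec_sub, Matrix.mulVec_smul, dotProduct_sub, dotProduct_smul, hv p,
      hI0 p, smul_zero, sub_zero]
  have hpos : 0 < r ⬝ᵥ g.mulVec r := by simpa using hg.dotProduct_mulVec_pos hr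
  -- The vector `r` and its three images are `g`-orthogonal of equal length, so `W` is invertible;
  -- `w`, the part of `v` that kills `r`, kills all four rows and vanishes.
  let R : Fin 4 → Fin 4 → ℝ :=
    ![r, Matrix.vecMul r (I 0), Matrix.vecMul r (I 1), Matrix.vecMul r (I 2)]
  let W : Matrix (Fin 4) (Fin 4) ℝ := Matrix.of R
  have hWw : W.mulVec w = 0 := by
    funext i
    have h := hwp
    simp only [Matrix.dotProduct_mulVec] at h
    fin_cases i
    · exact hw0
    · exact h 0
    · exact h 1
    · exact h 2
  have hgg : ∀ (A B : Matrix (Fin 4) (Fin 4) ℝ), Matrix.vecMul r A ⬝ᵥ g.mulVec (Matrix.vecMul r B) =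
      r ⬝ᵥ (A * g * B.transpose).mulVec r := by
    intro A B
    rw [← Matrix.mulVec_mulVec, ← Matrix.mulVec_mulVec, Matrix.mulVec_transpose,
      Matrix.dotProduct_mulVec r A]
  have hWW : W * g * W.transpose = (r ⬝ᵥ g.mulVec r) • (1 : Matrix (Fin 4) (Fin 4) ℝ) := by
    have hent : ∀ i j, (W * g * W.transpose) i j = R i ⬝ᵥ g.mulVec (R j) := by
      intro i j
      rw [mul_assoc, Matrix.mul_apply']
      rfl
    have hmix : ∀ p q k, I q * I p = -I k ∨ I q * I p = I k →
        Matrix.vecMul r (I p) ⬝ᵥ g.mulVec (Matrix.vecMul r (I q)) = 0 := by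
      intro p q k h
      rw [hbil, hgg, mul_assoc, hgI p, mul_neg, ← mul_assoc, Matrix.neg_mulVec, dotProduct_neg]
      rcases h with h | h <;> rw [h] <;>
        simp [← Matrix.mulVec_mulVec, hI0, Matrix.neg_mulVec]
    have hsame : ∀ p, Matrix.vecMul r (I p) ⬝ᵥ g.mulVec (Matrix.vecMul r (I p)) =
        r ⬝ᵥ g.mulVec r := fun p => by rw [hgg, hherm]
    have hr1 : ∀ p, r ⬝ᵥ g.mulVec (Matrix.vecMul r (I p)) = 0 := fun p => by
      rw [hbil, ← Matrix.dotProduct_mulVec, hI0]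
    have hr2 : ∀ p, Matrix.vecMul r (I p) ⬝ᵥ g.mulVec r = 0 := fun p => by
      rw [hbil, hr1]
    ext i j
    rw [hent]
    fin_cases i <;> fin_cases j <;> simp [R, hr1, hr2, hsame]
    · rw [hbil]; exact hmix 1 0 2 (.inr h01)
    · exact hmix 0 2 1 (.inr h20)
    · exact hmix 1 0 2 (.inr h01)
    · rw [hbil]; exact hmix 2 1 0 (.inr h12)
    · rw [hbil]; exact hmix 0 2 1 (.inr h20)
    · exact hmix 2 1 0 (.inr h12)
  have hdetW : IsUnit W.det := by
    rw [isUnit_iff_ne_zero]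
    intro h0
    have := congrArg Matrix.det hWW
    rw [Matrix.det_mul, Matrix.det_mul, h0, Matrix.det_smul, Matrix.det_one] at this
    have h4 := pow_pos hpos (Fintype.card (Fin 4))
    linarith
  have hwz : w = 0 := by
    have := congrArg (W⁻¹.mulVec) hWw
    rwa [Matrix.mulVec_mulVec, Matrix.nonsing_inv_mul _ hdetW, Matrix.one_mulVec,
      Matrix.mulVec_zero] at this
  exact sub_eq_zero.mp hwz

end Obstruction

/-! ### Vielbein transformations in dimension four are conformal. -/

section Vielbein

/-- The commutant of the unit quaternions acting on one side of `ℝ⁴` is the quaternions acting on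
the other side, and such a matrix is a multiple of an orthogonal one. -/
lemma mul_transpose_of_comm_canon {R : Matrix (Fin 1 × Fin 4) (Fin 1 × Fin 4) ℝ}
    (h : ∀ p, R * flatStructure 1 p = flatStructure 1 p * R) :
    ∃ r : ℝ, R * R.transpose = r • (1 : Matrix _ _ ℝ) := by
  have key : ∀ p (i j : Fin 4), ∑ k, R (0, i) (0, k) * canon p k j =
      ∑ k, canon p i k * R (0, k) (0, j) := by
    intro p i j
    have := congrFun (congrFun (h p) (0, i)) (0, j)
    simpa [Matrix.mul_apply, flatStructure, Fintype.sum_prod_type] using this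
  -- Row 0 of `canon p` is a basis vector, so the top row of each commutation relation gives one
  -- further row of `R` in terms of its row 0.
  have hq : R (0, 1) (0, 0) = -R (0, 0) (0, 1) ∧ R (0, 1) (0, 1) = R (0, 0) (0, 0) ∧
      R (0, 1) (0, 2) = -R (0, 0) (0, 3) ∧ R (0, 1) (0, 3) = R (0, 0) (0, 2) := by
    have k0 := key 2 0 0
    have k1 := key 2 0 1
    have k2 := key 2 0 2
    have k3 := key 2 0 3
    simp [canon, Fin.sum_univ_four] at k0 k1 k2 k3
    refine ⟨?_, ?_, ?_, ?_⟩ <;> linarith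
  have hr : R (0, 2) (0, 0) = -R (0, 0) (0, 2) ∧ R (0, 2) (0, 1) = R (0, 0) (0, 3) ∧
      R (0, 2) (0, 2) = R (0, 0) (0, 0) ∧ R (0, 2) (0, 3) = -R (0, 0) (0, 1) := by
    have k0 := key 1 0 0
    have k1 := key 1 0 1
    have k2 := key 1 0 2
    have k3 := key 1 0 3
    simp [canon, Fin.sum_univ_four] at k0 k1 k2 k3
    refine ⟨?_, ?_, ?_, ?_⟩ <;> linarith
  have hs : R (0, 3) (0, 0) = -R (0, 0) (0, 3) ∧ R (0, 3) (0, 1) = -R (0, 0) (0, 2) ∧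
      R (0, 3) (0, 2) = R (0, 0) (0, 1) ∧ R (0, 3) (0, 3) = R (0, 0) (0, 0) := by
    have k0 := key 0 0 0
    have k1 := key 0 0 1
    have k2 := key 0 0 2
    have k3 := key 0 0 3
    simp [canon, Fin.sum_univ_four] at k0 k1 k2 k3
    refine ⟨?_, ?_, ?_, ?_⟩ <;> linarith
  obtain ⟨q0, q1, q2, q3⟩ := hq
  obtain ⟨r0, r1, r2, r3⟩ := hr
  obtain ⟨s0, s1, s2, s3⟩ := hs
  refine ⟨∑ k, R (0, 0) (0, k) ^ 2, ?_⟩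
  have hent : ∀ i j : Fin 4, ∑ k, R (0, i) (0, k) * R (0, j) (0, k) =
      (∑ k, R (0, 0) (0, k) ^ 2) * if i = j then 1 else 0 := by
    intro i j
    fin_cases i <;> fin_cases j <;>
      simp [Fin.sum_univ_four, q0, q1, q2, q3, r0, r1, r2, r3, s0, s1, s2, s3] <;> ring
  ext ⟨i, i'⟩ ⟨j, j'⟩
  obtain rfl := Subsingleton.elim i 0
  obtain rfl := Subsingleton.elim j 0
  simpa [Matrix.mul_apply, Fintype.sum_prod_type, Matrix.one_apply] using hent i' j'

/-- In dimension four, structures related by a transformation of the vielbeins have the same complex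
structures and conformal metrics. -/
lemma VielbeinRelated.conformal {ι : Type*} [Fintype ι] [DecidableEq ι] {U : Set (ι → ℝ)}
    {g g' : (ι → ℝ) → Matrix ι ι ℝ} {I I' : Fin 3 → (ι → ℝ) → Matrix ι ι ℝ}
    (hg : ∀ x ∈ U, IsUnit (g x).det) (h : VielbeinRelated 1 U g I g' I') {x : ι → ℝ} (hx : x ∈ U) :
    (∀ p, I' p x = I p x) ∧ ∃ r : ℝ, g' x = r • g x := by
  obtain ⟨V, -, hxV, -, e, R, hR, he, he'⟩ := h x hx
  refine ⟨fun p => ?_, ?_⟩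
  · have h1 : (I' p x - I p x) * (e x * R x) = 0 := by
      rw [Matrix.sub_mul, he'.structures p x hxV, ← Matrix.mul_assoc (I p x), he.structures p x hxV,
        Matrix.mul_assoc, hR.comm p x hxV, Matrix.mul_assoc, sub_self]
    have h2 : (I' p x - I p x) * e x = 0 := by
      have := congrArg (· * (R x)⁻¹) h1
      simpa [Matrix.mul_assoc, Matrix.mul_nonsing_inv _ (hR.isUnit_det x hxV)] using this
    have h3 : (I' p x - I p x) * g x = 0 := by
      rw [← he.metric x hxV, ← Matrix.mul_assoc, h2, Matrix.zero_mul]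
    have h4 := congrArg (· * (g x)⁻¹) h3
    simp only [mul_assoc, Matrix.mul_nonsing_inv _ (hg x hx), mul_one, zero_mul] at h4
    exact sub_eq_zero.mp h4
  · obtain ⟨r, hr⟩ := mul_transpose_of_comm_canon fun p => hR.comm p x hxV
    refine ⟨r, ?_⟩
    rw [← he'.metric x hxV, Matrix.transpose_mul, Matrix.mul_assoc, ← Matrix.mul_assoc (R x), hr,
      ← he.metric x hxV]
    simp

/-- A hyper-Kähler structure obtained from `(g, I)` by a transformation of the vielbeins makes `I`
parallel for the Levi-Civita connection of a conformal rescaling of `g`. -/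
lemma VielbeinRelated.exists_conformal_factor {ι : Type*} [Fintype ι] [DecidableEq ι] [Nonempty ι]
    {U : Set (ι → ℝ)} {g g' : (ι → ℝ) → Matrix ι ι ℝ} {I I' : Fin 3 → (ι → ℝ) → Matrix ι ι ℝ}
    (hg : IsMetric U g) (h : VielbeinRelated 1 U g I g' I') (hk : IsHyperKahler U g' I') :
    ∃ G : (ι → ℝ) → ℝ, ContDiffOn ℝ ∞ G U ∧ (∀ x ∈ U, 0 < G x) ∧
      ∀ p, IsParallel U (leviCivita fun x => G x • g x) (I p) := by
  have hc : ∀ x ∈ U, (∀ p, I' p x = I p x) ∧ ∃ r : ℝ, g' x = r • g x :=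
    fun x hx => h.conformal (fun y hy => (hg.posDef y hy).det_pos.ne'.isUnit) hx
  have hm' := hk.hyperHermitian.metric
  let i : ι := Classical.arbitrary ι
  have hpos : ∀ x ∈ U, 0 < g x i i := fun x hx => (hg.posDef x hx).diag_pos
  -- The pointwise ratio of the metrics carries no regularity; a quotient of diagonal entries
  -- exhibits it as a smooth positive function.
  refine ⟨fun x => g' x i i / g x i i, (hm'.smooth i i).div (hg.smooth i i)
    fun x hx => (hpos x hx).ne', fun x hx => div_pos (hm'.posDef x hx).diag_pos (hpos x hx),
    fun p => (hk.parallel p).congr hm'.isOpen (fun x hx => ?_) fun x hx => (hc x hx).1 p⟩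
  obtain ⟨r, hr⟩ := (hc x hx).2
  have : g' x i i / g x i i = r := by
    rw [hr]
    simp [(hpos x hx).ne']
  change g' x = (g' x i i / g x i i) • g x
  rw [this, hr]

end Vielbein

/-! ### The obstruction for the Delduc–Valent torsion. -/

section DelducValentObstruction

lemma one_add_mul_pos_of_mem {lam : ℝ} {x : Fin 4 → ℝ} (hx : x ∈ dvDomain lam) :
    0 < 1 + lam * x 0 := by
  have h := mul_pos hx.2.1 hx.1
  have h0 : x 0 ≠ 0 := hx.1.ne'
  field_simp at h
  linarith

lemma sin_pos_of_mem {lam : ℝ} {x : Fin 4 → ℝ} (hx : x ∈ dvDomain lam) :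
    0 < Real.sin (x 2) := Real.sin_pos_of_pos_of_lt_pi hx.2.2.1 hx.2.2.2

lemma dvMetric_apply_one (lam rho : ℝ) (x : Fin 4 → ℝ) (M : Fin 4) :
    dvMetric lam rho x M 1 = (1 / 4) * (dvV lam x)⁻¹ * dvForm lam rho x M := by
  fin_cases M <;> simp [dvMetric, dvForm, dvGamma] <;> ring

/-- The form has only the `ds ∧ dθ ∧ dφ` component: its contraction with `∂_Ψ` vanishes, and the
other contractions read off the antisymmetric part of the `(s, θ, φ)` block of `N`. -/
lemma dvTorsion_contract (lam rho : ℝ) (x : Fin 4 → ℝ) :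
    ∃ t : ℝ, (rho ≠ 0 → x ∈ dvDomain lam → t ≠ 0) ∧ ∀ N : Matrix (Fin 4) (Fin 4) ℝ,
    (∑ S, ∑ M, dvTorsion lam rho x S 0 M * N S M = t * (N 3 2 - N 2 3)) ∧
    (∑ S, ∑ M, dvTorsion lam rho x S 1 M * N S M = 0) ∧
    (∑ S, ∑ M, dvTorsion lam rho x S 2 M * N S M = t * (N 0 3 - N 3 0)) ∧
    (∑ S, ∑ M, dvTorsion lam rho x S 3 M * N S M = t * (N 2 0 - N 0 2)) := by
  refine ⟨rho * x 0 * (1 + lam * x 0) / (1 + rho ^ 2 * x 0 ^ 2) ^ 2 * Real.sin (x 2), ?_, ?_⟩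
  · intro hr hx
    have h0 : x 0 ≠ 0 := hx.1.ne'
    have h1 := (one_add_mul_pos_of_mem hx).ne'
    have h2 := (sin_pos_of_mem hx).ne'
    have h3 : (1 + rho ^ 2 * x 0 ^ 2) ≠ 0 := by positivity
    positivity
  · intro N
    simp [dvTorsion, Fin.sum_univ_four, Matrix.det_fin_three]
    refine ⟨?_, ?_, ?_⟩ <;> ring

/-- The differential of a conformal factor that makes the complex structures parallel is a nonzero
multiple of `dΨ + ω`. -/
lemma pd_conformal_factor {lam rho c : ℝ} (hrho : rho ≠ 0) (hc : c ≠ 0) {U : Set (Fin 4 → ℝ)}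
    {I : Fin 3 → (Fin 4 → ℝ) → Matrix (Fin 4) (Fin 4) ℝ} (hU : U ⊆ dvDomain lam)
    (h : IsHKTWithTorsion U (dvMetric lam rho) I (fun x S P M => c * dvTorsion lam rho x S P M))
    {G : (Fin 4 → ℝ) → ℝ} {x : Fin 4 → ℝ} (hx : x ∈ U) (hG : DifferentiableAt ℝ G x)
    (hG0 : G x ≠ 0)
    (hpar : ∀ p, IsParallel U (leviCivita fun y => G y • dvMetric lam rho y) (I p)) :
    pd 1 G x ≠ 0 ∧ ∀ M, pd M G x = dvForm lam rho x M * pd 1 G x := by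
  have hh := h.hyperHermitian
  have hpos := hh.metric.posDef x hx
  set v : Fin 4 → ℝ := fun M => pd M G x with hv
  obtain ⟨t, ht, tN⟩ := dvTorsion_contract lam rho x
  have ht0 := ht hrho (hU hx)
  have key : ∀ p P, 2 * (I p x).mulVec v P =
      G x * c * ∑ S, ∑ M, dvTorsion lam rho x S P M * ((dvMetric lam rho x)⁻¹ * I p x) S M := by
    intro p P
    rw [h.mulVec_pd hx hG hG0 hpar p P]
    simp only [Finset.mul_sum, mul_assoc]
  -- Applied to `r = ∂_Ψ`, whose metric dual is proportional to `dΨ + ω`.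
  have hspan := quaternionic_span hpos (fun p => (hh.complex p).sq x hx)
    (fun p => hh.hermitian p x hx) (hh.mul01 x hx).1 (hh.mul12 x hx).1 (hh.mul20 x hx).1
    (r := Pi.single 1 1) (v := v) (by simp) fun p => by
      have := key p 1
      rw [(tN _).2.1, mul_zero] at this
      simpa using this
  have hV : 0 < dvV lam x := (hU hx).2.1
  have hprop : ∀ M, v M = dvForm lam rho x M * v 1 := by
    intro M
    have h1 := congrFun hspan M
    simp only [Matrix.mulVec_single_one, single_one_dotProduct, Pi.smul_apply, smul_eq_mul,
      Matrix.col_apply, dvMetric_apply_one] at h1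
    have h2 : dvForm lam rho x 1 = 1 := by simp [dvForm]
    rw [h2] at h1
    field_simp at h1
    linarith
  refine ⟨fun h1 => ?_, hprop⟩
  have hv0 : v = 0 := funext fun M => by
    rw [hprop M, show v 1 = 0 from h1, mul_zero, Pi.zero_apply]
  set N := (dvMetric lam rho x)⁻¹ * I 0 x with hN
  have hdet : IsUnit (dvMetric lam rho x).det := hpos.det_pos.ne'.isUnit
  have hsym : (dvMetric lam rho x).transpose = dvMetric lam rho x := hpos.isHermitian
  have hIu : IsUnit (I 0 x).det := by
    have := congrArg Matrix.det ((hh.complex 0).sq x hx)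
    rw [Matrix.det_mul, Matrix.det_neg, Matrix.det_one] at this
    rw [isUnit_iff_ne_zero]
    rintro h0
    norm_num [h0] at this
  have hanti : N.transpose = -N := by
    have h1 := hh.hermitian 0 x hx
    have h2 : I 0 x * dvMetric lam rho x = -(dvMetric lam rho x * (I 0 x).transpose) := by
      have h3 := congrArg (I 0 x * ·) h1
      simp only [← mul_assoc, (hh.complex 0).sq x hx, neg_mul, one_mul] at h3
      exact h3.symm
    have h4 := congrArg (fun A => (dvMetric lam rho x)⁻¹ * A * (dvMetric lam rho x)⁻¹) h2
    simp only [mul_neg, neg_mul, ← mul_assoc, Matrix.nonsing_inv_mul _ hdet, one_mul] at h4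
    rw [mul_assoc _ _ ((dvMetric lam rho x)⁻¹), Matrix.mul_nonsing_inv _ hdet, mul_one] at h4
    rw [hN, Matrix.transpose_mul, Matrix.transpose_nonsing_inv, hsym, h4, neg_neg]
  -- If `dG = 0`, all torsion contractions with `N = g⁻¹ I` vanish. As `N` is antisymmetric, its
  -- whole `(s, θ, φ)` block is then zero, which forces `det N = 0` although `N` is a product of
  -- invertible matrices.
  have hz : ∀ P, ∑ S, ∑ M, dvTorsion lam rho x S P M * N S M = 0 := by
    intro P
    have := key 0 P
    rw [hv0, Matrix.mulVec_zero, Pi.zero_apply, mul_zero] at this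
    exact (mul_eq_zero.mp this.symm).resolve_left (mul_ne_zero hG0 hc)
  have ha : ∀ i j, N j i = -N i j := fun i j => congrFun (congrFun hanti i) j
  have n0 := hz 0
  have n2 := hz 2
  have n3 := hz 3
  rw [(tN N).1] at n0
  rw [(tN N).2.2.1] at n2
  rw [(tN N).2.2.2] at n3
  have n32 := (mul_eq_zero.mp n0).resolve_left ht0
  have n03 := (mul_eq_zero.mp n2).resolve_left ht0
  have n20 := (mul_eq_zero.mp n3).resolve_left ht0
  have z23 : N 2 3 = 0 := by linarith [ha 2 3]
  have z03 : N 0 3 = 0 := by linarith [ha 0 3]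
  have z02 : N 0 2 = 0 := by linarith [ha 0 2]
  have hNdet : IsUnit N.det := by
    rw [hN, Matrix.det_mul]
    exact ((Matrix.isUnit_nonsing_inv_det _ hdet)).mul hIu
  apply hNdet.ne_zero
  have z00 : N 0 0 = 0 := by linarith [ha 0 0]
  have z22 : N 2 2 = 0 := by linarith [ha 2 2]
  have z20 : N 2 0 = 0 := by linarith [ha 0 2]
  have z30 : N 3 0 = 0 := by linarith [ha 0 3]
  rw [Matrix.det_succ_row_zero]
  simp [Fin.sum_univ_four, Matrix.det_fin_three, Fin.succAbove, z00, z22, z02, z03, z20, z30, z23]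

/-- The form `dΨ + ω` has no `dθ` component and `dφ` component `cos θ`. Hence `∂_θ G = 0`, whereas
`∂_θ ∂_φ G = -sin θ ∂_Ψ G ≠ 0`, against the symmetry of second derivatives. -/
lemma not_exists_conformal_factor {lam rho c : ℝ} (hrho : rho ≠ 0) (hc : c ≠ 0)
    {U : Set (Fin 4 → ℝ)} {I : Fin 3 → (Fin 4 → ℝ) → Matrix (Fin 4) (Fin 4) ℝ} (hne : U.Nonempty)
    (hU : U ⊆ dvDomain lam)
    (h : IsHKTWithTorsion U (dvMetric lam rho) I (fun x S P M => c * dvTorsion lam rho x S P M)) :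
    ¬ ∃ G : (Fin 4 → ℝ) → ℝ, ContDiffOn ℝ ∞ G U ∧ (∀ x ∈ U, 0 < G x) ∧
      ∀ p, IsParallel U (leviCivita fun x => G x • dvMetric lam rho x) (I p) := by
  rintro ⟨G, hG, hG0, hpar⟩
  obtain ⟨x, hx⟩ := hne
  have hUo := h.hyperHermitian.metric.isOpen
  have key : ∀ y ∈ U, pd 1 G y ≠ 0 ∧ ∀ M, pd M G y = dvForm lam rho y M * pd 1 G y :=
    fun y hy => pd_conformal_factor hrho hc hU h hy (differentiableAt_of_contDiffOn hUo hy hG)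
      (hG0 y hy).ne' hpar
  have hGx := hG.contDiffAt (hUo.mem_nhds hx)
  have h2 : ∀ M, pd M (pd 2 G) x = 0 := by
    intro M
    rw [pd_congr (k := fun _ => 0) hUo hx fun y hy => by simp [(key y hy).2 2, dvForm], pd_const]
  have h3 : pd 2 (pd 3 G) x = -Real.sin (x 2) * pd 1 G x := by
    rw [pd_congr (k := fun y => Real.cos (y 2) * pd 1 G y) hUo hx
      fun y hy => by rw [(key y hy).2 3]; simp [dvForm]]
    rw [pd_mul (by fun_prop) (differentiableAt_pd hGx 1), pd_comm hGx 2 1, h2, mul_zero, add_zero,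
      pd_comp (Real.hasDerivAt_cos (x 2)) (by fun_prop), pd_coord]
    simp
  rw [pd_comm hGx, h2] at h3
  have h4 := mul_ne_zero (neg_ne_zero.mpr (sin_pos_of_mem (hU hx)).ne') (key x hx).1
  exact h4 h3.symm

end DelducValentObstruction

/-! ### Connections with torsion in an orthonormal frame. -/

section Frame

variable {ι : Type*} [Fintype ι]

lemma contDiffOn_det {κ : Type*} [Fintype κ] [DecidableEq κ] {U : Set (ι → ℝ)}
    {A : (ι → ℝ) → Matrix κ κ ℝ} (hA : SmoothOn U A) :
    ContDiffOn ℝ ∞ (fun x => (A x).det) U := by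
  simp only [Matrix.det_apply']
  exact ContDiffOn.sum fun σ _ => contDiffOn_const.mul (contDiffOn_prod fun i _ => hA _ _)

lemma SmoothOn.mul {α β γ : Type*} [Fintype β] {U : Set (ι → ℝ)} {A : (ι → ℝ) → Matrix α β ℝ}
    {B : (ι → ℝ) → Matrix β γ ℝ} (hA : SmoothOn U A) (hB : SmoothOn U B) :
    SmoothOn U fun x => A x * B x := fun a c => by
  simp only [Matrix.mul_apply]
  exact ContDiffOn.sum fun b _ => (hA a b).mul (hB b c)

lemma SmoothOn.inv {κ : Type*} [Fintype κ] [DecidableEq κ] {U : Set (ι → ℝ)}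
    {A : (ι → ℝ) → Matrix κ κ ℝ} (hA : SmoothOn U A) (hdet : ∀ x ∈ U, (A x).det ≠ 0) :
    SmoothOn U fun x => (A x)⁻¹ := fun a b => by
  simp only [Matrix.inv_def, Ring.inverse_eq_inv', Matrix.smul_apply, smul_eq_mul,
    Matrix.adjugate_apply]
  refine ((contDiffOn_det hA).inv hdet).mul (contDiffOn_det fun i j => ?_)
  simp only [Matrix.updateRow_apply]
  split_ifs
  · exact contDiffOn_const
  · exact hA i j

variable [DecidableEq ι]

/-- A metric connection given by its coefficients `B` in an orthonormal frame, with completely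
antisymmetric torsion `C`, is the connection `Γ + ½ g⁻¹ C`. -/
lemma connMatrix_torsionConnection_of_frame {U : Set (ι → ℝ)} (hU : IsOpen U)
    {g e : (ι → ℝ) → Matrix ι ι ℝ} (he : SmoothOn U e)
    (heg : ∀ x ∈ U, e x * (e x).transpose = g x) {x : ι → ℝ} (hx : x ∈ U)
    (hdet : IsUnit (e x).det) {C : (ι → ℝ) → ι → ι → ι → ℝ}
    (hC : ∀ S P M, C x P S M = -C x S P M) {B : ι → Matrix ι ι ℝ}
    (hB : ∀ P, (B P).transpose = -B P) {W : ι → Matrix ι ι ℝ}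
    (hW : ∀ P, W P = matPd P e x + e x * (B P).transpose)
    (htors : ∀ S P M, ∑ A, e x S A * (W P M A - W M P A) = C x S P M) (P : ι) :
    connMatrix (torsionConnection g C) x P = W P * (e x)⁻¹ := by
  have hd : ∀ a b, DifferentiableAt ℝ (fun y => e y a b) x := fun a b =>
    differentiableAt_of_contDiffOn hU hx (he a b)
  have hdg : ∀ K, matPd K g x = W K * (e x).transpose + e x * (W K).transpose := by
    intro K
    have h1 : matPd K (fun y => (e y).transpose) x = (matPd K e x).transpose := rfl
    rw [matPd_congr hU hx fun y hy => (heg y hy).symm,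
      matPd_mul (B := fun y => (e y).transpose) K hd fun a b => hd b a, h1, hW,
      Matrix.transpose_add, Matrix.transpose_mul, Matrix.transpose_transpose, hB]
    noncomm_ring
  have hdg' : ∀ K S M, pd K (fun y => g y S M) x =
      ∑ A, e x M A * W K S A + ∑ A, e x S A * W K M A := by
    intro K S M
    have := congrFun (congrFun (hdg K) S) M
    simp only [Matrix.add_apply, Matrix.mul_apply, Matrix.transpose_apply] at this
    rw [show pd K (fun y => g y S M) x = matPd K g x S M from rfl, this]
    simp only [mul_comm]
  have htors' : ∀ S P M, ∑ A, e x S A * W P M A - ∑ A, e x S A * W M P A = C x S P M := by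
    intro S P M
    rw [← htors, ← Finset.sum_sub_distrib]
    simp only [mul_sub]
  ext M Q
  have hconn : connMatrix (torsionConnection g C) x P M Q =
      ∑ S, (g x)⁻¹ Q S * ∑ A, e x S A * W P M A := by
    simp only [connMatrix, torsionConnection, leviCivita, Matrix.of_apply,
      Finset.mul_sum (s := Finset.univ) (a := (1 / 2 : ℝ))]
    rw [← Finset.sum_add_distrib]
    refine Finset.sum_congr rfl fun S _ => ?_
    rw [hdg', hdg', hdg']
    -- The Koszul computation: three permutations of the torsion identity turn the symmetrized
    -- derivatives of `g` into the single term `e W`.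
    linear_combination (1 / 2) * (g x)⁻¹ Q S *
      (htors' M P S + htors' P M S - htors' S P M + hC M P S)
  have hmat : (g x)⁻¹ = ((e x)⁻¹).transpose * (e x)⁻¹ := by
    rw [← heg x hx, Matrix.mul_inv_rev, Matrix.transpose_nonsing_inv]
  have hsum : ∑ S, (g x)⁻¹ Q S * ∑ A, e x S A * W P M A =
      ((g x)⁻¹ * (e x * (W P).transpose)) Q M := by
    simp only [Matrix.mul_apply, Matrix.transpose_apply]
  rw [hconn, hsum, hmat, mul_assoc, ← mul_assoc (e x)⁻¹, Matrix.nonsing_inv_mul _ hdet, one_mul,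
    ← Matrix.transpose_mul, Matrix.transpose_apply]

/-- A tensor with constant components `J` in a frame is parallel for a connection whose
coefficients in the frame commute with `J`. -/
lemma isParallel_of_frame {U : Set (ι → ℝ)} (hU : IsOpen U) {e : (ι → ℝ) → Matrix ι ι ℝ}
    (he : SmoothOn U e) (hdet : ∀ x ∈ U, (e x).det ≠ 0) {Γ : Connection ι} {J : Matrix ι ι ℝ}
    {B : (ι → ℝ) → ι → Matrix ι ι ℝ}
    (hΓ : ∀ x ∈ U, ∀ P, connMatrix Γ x P = (matPd P e x + e x * (B x P).transpose) * (e x)⁻¹)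
    (hB : ∀ x ∈ U, ∀ P, (B x P).transpose * J = J * (B x P).transpose) :
    IsParallel U Γ fun x => e x * J * (e x)⁻¹ := by
  have hIs : SmoothOn U fun x => e x * J * (e x)⁻¹ :=
    SmoothOn.mul (A := fun x => e x * J) (B := fun x => (e x)⁻¹)
      (SmoothOn.mul (B := fun _ => J) he fun _ _ => contDiffOn_const) (he.inv hdet)
  generalize hI : (fun x => e x * J * (e x)⁻¹) = I at hIs ⊢
  replace hI : ∀ y, I y = e y * J * (e y)⁻¹ := fun y => by rw [← hI]
  intro x hx P M N
  have hu : IsUnit (e x).det := (hdet x hx).isUnit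
  rw [covDeriv_eq, hΓ x hx]
  have hIe : ∀ y ∈ U, I y * e y = e y * J := fun y hy => by
    rw [hI, mul_assoc, Matrix.nonsing_inv_mul _ (hdet y hy).isUnit, mul_one]
  have hd : ∀ a b, DifferentiableAt ℝ (fun y => e y a b) x := fun a b =>
    differentiableAt_of_contDiffOn hU hx (he a b)
  have hdI : ∀ a b, DifferentiableAt ℝ (fun y => I y a b) x := fun a b =>
    differentiableAt_of_contDiffOn hU hx (hIs a b)
  have h1 := matPd_congr (P := P) hU hx hIe
  have hJ : matPd P (fun _ : ι → ℝ => J) x = 0 := by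
    ext a b
    exact pd_const _ _ _
  rw [matPd_mul P hdI hd, matPd_mul (B := fun _ => J) P hd fun a b => differentiableAt_const _, hJ,
    mul_zero, add_zero] at h1
  have h2 : matPd P I x = (matPd P e x * J - I x * matPd P e x) * (e x)⁻¹ := by
    rw [← h1, add_sub_cancel_right, mul_assoc, Matrix.mul_nonsing_inv _ hu, mul_one]
  have h3 : (e x)⁻¹ * I x = J * (e x)⁻¹ := by
    rw [hI, mul_assoc, ← mul_assoc, Matrix.nonsing_inv_mul _ hu, one_mul]
  have h4 : (matPd P e x + e x * (B x P).transpose) * (e x)⁻¹ * I x =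
      (matPd P e x * J + e x * (J * (B x P).transpose)) * (e x)⁻¹ := by
    rw [mul_assoc, h3, ← mul_assoc, add_mul, mul_assoc (e x), hB x hx]
  have h5 : I x * ((matPd P e x + e x * (B x P).transpose) * (e x)⁻¹) =
      (I x * matPd P e x + e x * (J * (B x P).transpose)) * (e x)⁻¹ := by
    rw [← mul_assoc, mul_add, ← mul_assoc, hIe x hx, mul_assoc (e x)]
  rw [h2, h4, h5, ← sub_mul, ← add_mul,
    show matPd P e x * J - I x * matPd P e x - (matPd P e x * J + e x * (J * (B x P).transpose)) +
      (I x * matPd P e x + e x * (J * (B x P).transpose)) = 0 by abel, zero_mul,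
    Matrix.zero_apply]

/-- An almost complex structure parallel for a connection is integrable if the torsion `Ω` of the
connection satisfies `I Ω(X, Y) - Ω(X, I Y) - Ω(I X, Y) - I Ω(I X, I Y) = 0`. -/
lemma integrable_of_isParallel {I : (ι → ℝ) → Matrix ι ι ℝ} {x : ι → ℝ} {Γ : Connection ι}
    (hsq : I x * I x = -1) (hpar : ∀ P M N, covDeriv Γ I x P M N = 0) {Ω : ι → Matrix ι ι ℝ}
    (hΩ : ∀ P M N, Ω P M N = Γ x P M N - Γ x P N M)
    (h : ∀ P, ∑ Q, I x Q P • Ω Q - Ω P * (I x).transpose - I x * Ω P -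
      I x * (∑ Q, I x Q P • Ω Q) * (I x).transpose = 0) (M N P : ι) :
    pd M (fun y => I y N P) x - pd N (fun y => I y M P) x =
      ∑ Q, ∑ S, I x M Q * I x N S * (pd Q (fun y => I y S P) x - pd S (fun y => I y Q P) x) := by
  have hpd : ∀ K L, pd K (fun y => I y L P) x =
      ∑ Q, Γ x Q K L * I x Q P - ∑ Q, Γ x P K Q * I x L Q := fun K L => by
    have := hpar K L P
    rw [covDeriv] at this
    linarith
  have hdiff : ∀ K L, pd K (fun y => I y L P) x - pd L (fun y => I y K P) x =
      (∑ Q, I x Q P • Ω Q) K L - ∑ Q, Γ x P K Q * I x L Q + ∑ Q, Γ x P L Q * I x K Q := by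
    intro K L
    rw [hpd, hpd]
    simp only [Matrix.sum_apply, Matrix.smul_apply, smul_eq_mul, hΩ, mul_sub,
      Finset.sum_sub_distrib]
    simp only [mul_comm]
    ring
  simp only [hdiff]
  have hsq' : ∀ A B, ∑ S, I x A S * I x S B = -(1 : Matrix ι ι ℝ) A B := fun A B => by
    rw [← Matrix.mul_apply, hsq, Matrix.neg_apply]
  have h0 := congrFun (congrFun (h P) M) N
  set Y := ∑ Q, I x Q P • Ω Q with hY
  have e1 : ∑ Q, ∑ S, I x M Q * I x N S * Y Q S = (I x * Y * (I x).transpose) M N := by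
    simp only [Matrix.mul_apply, Matrix.transpose_apply, Finset.sum_mul]
    rw [Finset.sum_comm]
    exact Finset.sum_congr rfl fun S _ => Finset.sum_congr rfl fun Q _ => by ring
  have e2 : ∑ Q, ∑ S, I x M Q * I x N S * ∑ K, Γ x P Q K * I x S K =
      -∑ Q, Γ x P Q N * I x M Q := by
    rw [← Finset.sum_neg_distrib]
    refine Finset.sum_congr rfl fun Q _ => ?_
    simp only [Finset.mul_sum]
    rw [Finset.sum_comm]
    have : ∀ K, ∑ S, I x M Q * I x N S * (Γ x P Q K * I x S K) =
        I x M Q * Γ x P Q K * -(1 : Matrix ι ι ℝ) N K := fun K => by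
      rw [← hsq', Finset.mul_sum]
      exact Finset.sum_congr rfl fun S _ => by ring
    simp only [this, Matrix.one_apply]
    simp [mul_comm]
  have e3 : ∑ Q, ∑ S, I x M Q * I x N S * ∑ K, Γ x P S K * I x Q K =
      -∑ S, Γ x P S M * I x N S := by
    rw [Finset.sum_comm, ← Finset.sum_neg_distrib]
    refine Finset.sum_congr rfl fun S _ => ?_
    simp only [Finset.mul_sum]
    rw [Finset.sum_comm]
    have : ∀ K, ∑ Q, I x M Q * I x N S * (Γ x P S K * I x Q K) =
        I x N S * Γ x P S K * -(1 : Matrix ι ι ℝ) M K := fun K => by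
      rw [← hsq', Finset.mul_sum]
      exact Finset.sum_congr rfl fun Q _ => by ring
    simp only [this, Matrix.one_apply]
    simp [mul_comm]
  simp only [mul_sub, mul_add, Finset.sum_sub_distrib, Finset.sum_add_distrib, e1, e2, e3]
  have e4 : (Ω P * (I x).transpose) M N =
      ∑ Q, Γ x P M Q * I x N Q - ∑ Q, Γ x P Q M * I x N Q := by
    simp only [Matrix.mul_apply, Matrix.transpose_apply, hΩ, sub_mul, Finset.sum_sub_distrib]
  have e5 : (I x * Ω P) M N = ∑ Q, Γ x P Q N * I x M Q - ∑ Q, Γ x P N Q * I x M Q := by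
    simp only [Matrix.mul_apply, hΩ, mul_sub, Finset.sum_sub_distrib]
    simp only [mul_comm]
  simp only [Matrix.sub_apply, Matrix.zero_apply, e4, e5] at h0
  linarith

end Frame

/-! ### From an anti-self-dual frame connection to an HKT structure. -/

section FrameCriterion

/-- The components in a frame of the torsion 3-form `t e¹ ∧ e² ∧ e³`; the first index labels the
matrix. -/
def spatialTorsion (t : ℝ) : Fin 4 → Matrix (Fin 4) (Fin 4) ℝ := ![0,
  !![0, 0, 0, 0; 0, 0, 0, 0; 0, 0, 0, t; 0, 0, -t, 0],
  !![0, 0, 0, 0; 0, 0, 0, -t; 0, 0, 0, 0; 0, t, 0, 0],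
  !![0, 0, 0, 0; 0, 0, t, 0; 0, -t, 0, 0; 0, 0, 0, 0]]

/-- The anti-self-dual matrices. -/
def antiSelfDual (b : Fin 3 → ℝ) : Matrix (Fin 4) (Fin 4) ℝ :=
  !![0, -b 0, -b 1, -b 2; b 0, 0, b 2, -b 1; b 1, -b 2, 0, b 0; b 2, b 1, -b 0, 0]

lemma antiSelfDual_transpose (b : Fin 3 → ℝ) : (antiSelfDual b).transpose = -antiSelfDual b := by
  ext i j
  fin_cases i <;> fin_cases j <;> simp [antiSelfDual]

/-- The two three-dimensional ideals of `so(4)` commute, and `canon` spans the other one. -/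
lemma antiSelfDual_comm (b : Fin 3 → ℝ) (p : Fin 3) :
    (antiSelfDual b).transpose * canon p = canon p * (antiSelfDual b).transpose := by
  ext i j
  fin_cases p <;> fin_cases i <;> fin_cases j <;>
    simp [antiSelfDual, canon, Matrix.mul_apply, Fin.sum_univ_four]

lemma canon_sq (p : Fin 3) : canon p * canon p = -1 := by
  ext i j
  fin_cases p <;> fin_cases i <;> fin_cases j <;>
    simp [canon, Matrix.mul_apply, Fin.sum_univ_four]

lemma canon_transpose (p : Fin 3) : (canon p).transpose = -canon p := by
  ext i j
  fin_cases p <;> fin_cases i <;> fin_cases j <;> simp [canon]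

lemma canon_mul : canon 0 * canon 1 = canon 2 ∧ canon 1 * canon 2 = canon 0 ∧
    canon 2 * canon 0 = canon 1 := by
  refine ⟨?_, ?_, ?_⟩ <;> ext i j <;> fin_cases i <;> fin_cases j <;>
    simp [canon, Matrix.mul_apply, Fin.sum_univ_four]

lemma canon_mul' : canon 1 * canon 0 = -canon 2 ∧ canon 2 * canon 1 = -canon 0 ∧
    canon 0 * canon 2 = -canon 1 := by
  refine ⟨?_, ?_, ?_⟩ <;> ext i j <;> fin_cases i <;> fin_cases j <;>
    simp [canon, Matrix.mul_apply, Fin.sum_univ_four]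

/-- A 3-form in dimension four has no component of type (3,0) + (0,3). -/
lemma spatialTorsion_type (t : ℝ) (p : Fin 3) (C : Fin 4) :
    ∑ F, canon p F C • spatialTorsion t F - spatialTorsion t C * (canon p).transpose -
      canon p * spatialTorsion t C -
      canon p * (∑ F, canon p F C • spatialTorsion t F) * (canon p).transpose = 0 := by
  rw [canon_transpose]
  fin_cases p <;> fin_cases C <;>
    simp [Fin.sum_univ_four, canon, spatialTorsion, ← Matrix.ext_iff, Fin.forall_fin_succ]

/-- An orthonormal frame `e` and a connection that is anti-self-dual in this frame, with torsion
`t e¹ ∧ e² ∧ e³`, define an HKT structure. -/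
theorem isHKTWithTorsion_of_frame {U : Set (Fin 4 → ℝ)}
    {g e : (Fin 4 → ℝ) → Matrix (Fin 4) (Fin 4) ℝ} (hg : IsMetric U g) (he : SmoothOn U e)
    (heg : ∀ x ∈ U, e x * (e x).transpose = g x)
    {C : (Fin 4 → ℝ) → Fin 4 → Fin 4 → Fin 4 → ℝ}
    (hCs : ∀ S P M, ContDiffOn ℝ ∞ (fun x => C x S P M) U)
    (hCl : ∀ x ∈ U, ∀ S P M, C x P S M = -C x S P M)
    (hCr : ∀ x ∈ U, ∀ S P M, C x S M P = -C x S P M)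
    {b : (Fin 4 → ℝ) → Fin 4 → Fin 3 → ℝ} {t : (Fin 4 → ℝ) → ℝ}
    (hstr : ∀ x ∈ U, ∀ P M A,
      (matPd P e x + e x * (antiSelfDual (b x P)).transpose) M A -
        (matPd M e x + e x * (antiSelfDual (b x M)).transpose) P A =
      (e x * spatialTorsion (t x) A * (e x).transpose) P M)
    (hC : ∀ x ∈ U, ∀ S P M, C x S P M =
      ∑ A, e x S A * (e x * spatialTorsion (t x) A * (e x).transpose) P M) :
    IsHKTWithTorsion U g (fun p x => e x * canon p * (e x)⁻¹) C := by
  have hU := hg.isOpen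
  have hdet : ∀ x ∈ U, (e x).det ≠ 0 := by
    intro x hx h0
    have h1 := (hg.posDef x hx).det_pos
    rw [← heg x hx, Matrix.det_mul, h0, zero_mul] at h1
    exact lt_irrefl _ h1
  have hinv : ∀ x ∈ U, (e x)⁻¹ * e x = 1 := fun x hx =>
    Matrix.nonsing_inv_mul _ (hdet x hx).isUnit
  have hinv' : ∀ x ∈ U, e x * (e x)⁻¹ = 1 := fun x hx =>
    Matrix.mul_nonsing_inv _ (hdet x hx).isUnit
  have hΓ : ∀ x ∈ U, ∀ P, connMatrix (torsionConnection g C) x P =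
      (matPd P e x + e x * (antiSelfDual (b x P)).transpose) * (e x)⁻¹ := by
    intro x hx P
    refine connMatrix_torsionConnection_of_frame hU he heg hx (hdet x hx).isUnit (hCl x hx)
      (B := fun P => antiSelfDual (b x P)) (fun P => antiSelfDual_transpose _)
      (W := fun P => matPd P e x + e x * (antiSelfDual (b x P)).transpose) (fun _ => rfl)
      (fun S P M => ?_) P
    rw [hC x hx]
    exact Finset.sum_congr rfl fun A _ => by rw [hstr x hx]
  have hpar : ∀ p, IsParallel U (torsionConnection g C) fun x => e x * canon p * (e x)⁻¹ :=
    fun p => isParallel_of_frame hU he hdet (B := fun x P => antiSelfDual (b x P)) hΓ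
      fun x _ P => antiSelfDual_comm _ _
  have hmul : ∀ x ∈ U, ∀ A B : Matrix (Fin 4) (Fin 4) ℝ,
      e x * A * (e x)⁻¹ * (e x * B * (e x)⁻¹) = e x * (A * B) * (e x)⁻¹ := by
    intro x hx A B
    calc e x * A * (e x)⁻¹ * (e x * B * (e x)⁻¹)
        = e x * A * ((e x)⁻¹ * e x) * B * (e x)⁻¹ := by noncomm_ring
      _ = e x * (A * B) * (e x)⁻¹ := by rw [hinv x hx]; noncomm_ring
  have hsq : ∀ p, ∀ x ∈ U, e x * canon p * (e x)⁻¹ * (e x * canon p * (e x)⁻¹) = -1 := by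
    intro p x hx
    rw [hmul x hx, canon_sq, mul_neg, mul_one, neg_mul, hinv' x hx]
  have hIe : ∀ p, ∀ x ∈ U, e x * canon p * (e x)⁻¹ * e x = e x * canon p := fun p x hx => by
    rw [mul_assoc, hinv x hx, mul_one]
  refine ⟨⟨hg, fun p => ⟨?_, hsq p, fun x hx => ?_⟩, fun p x hx => ?_, fun x hx => ?_,
    fun x hx => ?_, fun x hx => ?_⟩, hCs, hCl, hCr, hpar⟩
  · exact SmoothOn.mul (A := fun x => e x * canon p) (B := fun x => (e x)⁻¹)
      (SmoothOn.mul (B := fun _ => canon p) he fun _ _ => contDiffOn_const) (he.inv hdet)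
  -- `τ P` has its upper index in coordinates and its lower indices in the frame; the integrability
  -- condition is transported to the frame, where it is `spatialTorsion_type`.
  · set τ : Fin 4 → Matrix (Fin 4) (Fin 4) ℝ :=
      fun P => ∑ A, (e x)⁻¹ A P • spatialTorsion (t x) A with hτ
    have hΓ' : ∀ P M Q, torsionConnection g C x Q P M =
        ((matPd P e x + e x * (antiSelfDual (b x P)).transpose) * (e x)⁻¹) M Q := fun P M Q => by
      rw [← hΓ x hx P]; rfl
    refine integrable_of_isParallel (Ω := fun P => e x * τ P * (e x).transpose) (hsq p x hx)
      (hpar p x hx) (fun P M N => ?_) fun P => ?_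
    · rw [hΓ', hΓ', Matrix.mul_apply (N := (e x)⁻¹), Matrix.mul_apply (N := (e x)⁻¹),
        ← Finset.sum_sub_distrib]
      simp only [← sub_mul, hstr x hx]
      simp only [hτ, Matrix.mul_sum, Matrix.sum_mul, Matrix.sum_apply, Matrix.mul_smul,
        Matrix.smul_mul, Matrix.smul_apply, smul_eq_mul]
      exact Finset.sum_congr rfl fun A _ => mul_comm _ _
    · have h1 : ∑ Q, (e x * canon p * (e x)⁻¹) Q P • (e x * τ Q * (e x).transpose) =
          e x * (∑ A, (e x)⁻¹ A P • ∑ F, canon p F A • spatialTorsion (t x) F) *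
            (e x).transpose := by
        have h2 : ∑ Q, (e x * canon p * (e x)⁻¹) Q P • τ Q =
            ∑ A, (e x)⁻¹ A P • ∑ F, canon p F A • spatialTorsion (t x) F := by
          have h3 : ∀ F, ∑ Q, (e x * canon p * (e x)⁻¹) Q P * (e x)⁻¹ F Q =
              ∑ A, (e x)⁻¹ A P * canon p F A := by
            intro F
            have : ((e x)⁻¹ * (e x * canon p * (e x)⁻¹)) F P = (canon p * (e x)⁻¹) F P := by
              rw [← mul_assoc, ← mul_assoc, hinv x hx, one_mul]
            simp only [Matrix.mul_apply (M := (e x)⁻¹), Matrix.mul_apply (M := canon p)] at this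
            simpa only [mul_comm] using this
          simp only [hτ, Finset.smul_sum, smul_smul]
          rw [Finset.sum_comm]
          conv_rhs => rw [Finset.sum_comm]
          refine Finset.sum_congr rfl fun F _ => ?_
          rw [← Finset.sum_smul, ← Finset.sum_smul, h3]
        rw [← h2]
        simp only [Matrix.mul_sum, Matrix.sum_mul, Matrix.mul_smul, Matrix.smul_mul]
      have h4 : (e x).transpose * (e x * canon p * (e x)⁻¹).transpose =
          (canon p).transpose * (e x).transpose := by
        rw [← Matrix.transpose_mul, hIe p x hx, Matrix.transpose_mul]
      rw [h1]
      set Y := ∑ A, (e x)⁻¹ A P • ∑ F, canon p F A • spatialTorsion (t x) F with hY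
      have h5 : Y - τ P * (canon p).transpose - canon p * τ P -
          canon p * Y * (canon p).transpose = 0 := by
        have h6 : ∀ A, (e x)⁻¹ A P • (∑ F, canon p F A • spatialTorsion (t x) F -
            spatialTorsion (t x) A * (canon p).transpose - canon p * spatialTorsion (t x) A -
            canon p * (∑ F, canon p F A • spatialTorsion (t x) F) * (canon p).transpose) = 0 :=
          fun A => by rw [spatialTorsion_type, smul_zero]
        have h7 := Finset.sum_congr (s₁ := Finset.univ) rfl fun A _ => h6 A
        simp only [smul_sub, Finset.sum_sub_distrib, Finset.sum_const_zero] at h7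
        rw [← h7, hτ, hY]
        simp only [Finset.sum_mul, Finset.mul_sum, smul_mul_assoc, mul_smul_comm]
      calc e x * Y * (e x).transpose -
            e x * τ P * (e x).transpose * (e x * canon p * (e x)⁻¹).transpose -
            e x * canon p * (e x)⁻¹ * (e x * τ P * (e x).transpose) -
            e x * canon p * (e x)⁻¹ * (e x * Y * (e x).transpose) *
              (e x * canon p * (e x)⁻¹).transpose
          = e x * Y * (e x).transpose -
            e x * τ P * ((e x).transpose * (e x * canon p * (e x)⁻¹).transpose) -
            (e x * canon p * (e x)⁻¹ * e x) * τ P * (e x).transpose -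
            (e x * canon p * (e x)⁻¹ * e x) * Y *
              ((e x).transpose * (e x * canon p * (e x)⁻¹).transpose) := by
            simp only [mul_assoc]
        _ = e x * (Y - τ P * (canon p).transpose - canon p * τ P -
            canon p * Y * (canon p).transpose) * (e x).transpose := by
            rw [h4, hIe p x hx]; noncomm_ring
        _ = 0 := by rw [h5, mul_zero, zero_mul]
  · have h4 : (e x).transpose * (e x * canon p * (e x)⁻¹).transpose =
        (canon p).transpose * (e x).transpose := by
      rw [← Matrix.transpose_mul, hIe p x hx, Matrix.transpose_mul]
    rw [← heg x hx, ← mul_assoc, hIe p x hx, mul_assoc _ _ ((_ * _ * _ : Matrix _ _ ℝ).transpose),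
      h4, canon_transpose, neg_mul, mul_neg, ← mul_assoc, mul_assoc (e x), canon_sq]
    simp
  · simp only [hmul x hx, canon_mul.1, canon_mul'.1]
    simp
  · simp only [hmul x hx, canon_mul.2.1, canon_mul'.2.1]
    simp
  · simp only [hmul x hx, canon_mul.2.2, canon_mul'.2.2]
    simp

end FrameCriterion

/-! ### The Gibbons–Hawking type frame over the 3-sphere. -/

section Monopole

/-- The frame of `V⁻¹ η² + V σ²`, up to a factor 2, with `u = √V`. -/
noncomputable def monopoleFrame (u : ℝ) (η : Fin 4 → ℝ) (σ : Fin 4 → Fin 3 → ℝ) :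
    Matrix (Fin 4) (Fin 4) ℝ :=
  Matrix.of fun M => ![-(η M / (2 * u)), u * σ M 0 / 2, u * σ M 1 / 2, u * σ M 2 / 2]

/-- The structure equations of `monopoleFrame` for a solution of the monopole equation
`dV = -m·σ`, `dη = -m·(σ × σ)/2` on a 3-sphere with `dσ = ρ σ × σ`. -/
lemma monopoleFrame_structure {x : Fin 4 → ℝ}
    {u : (Fin 4 → ℝ) → ℝ} {η : Fin 4 → (Fin 4 → ℝ) → ℝ} {σ : Fin 4 → Fin 3 → (Fin 4 → ℝ) → ℝ}
    (hu : DifferentiableAt ℝ u x) (hη : ∀ M, DifferentiableAt ℝ (η M) x)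
    (hσ : ∀ M i, DifferentiableAt ℝ (σ M i) x) (hu0 : u x ≠ 0) {m : Fin 3 → ℝ} {ρ : ℝ}
    (hdu : ∀ P, pd P u x = -(∑ i, m i * σ P i x) / (2 * u x))
    (hdη : ∀ P M, pd P (η M) x - pd M (η P) x =
      -(m 0 * (σ P 1 x * σ M 2 x - σ P 2 x * σ M 1 x) +
        m 1 * (σ P 2 x * σ M 0 x - σ P 0 x * σ M 2 x) +
        m 2 * (σ P 0 x * σ M 1 x - σ P 1 x * σ M 0 x)))
    (hσ0 : ∀ P M, pd P (σ M 0) x - pd M (σ P 0) x =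
      2 * ρ * (σ P 1 x * σ M 2 x - σ P 2 x * σ M 1 x))
    (hσ1 : ∀ P M, pd P (σ M 1) x - pd M (σ P 1) x =
      2 * ρ * (σ P 2 x * σ M 0 x - σ P 0 x * σ M 2 x))
    (hσ2 : ∀ P M, pd P (σ M 2) x - pd M (σ P 2) x =
      2 * ρ * (σ P 0 x * σ M 1 x - σ P 1 x * σ M 0 x))
    {e : (Fin 4 → ℝ) → Matrix (Fin 4) (Fin 4) ℝ}
    (he : e = fun y => monopoleFrame (u y) (fun M => η M y) (fun M i => σ M i y))
    {b : Fin 4 → Fin 3 → ℝ}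
    (hb : b = fun P =>
      ![m 0 * η P x / (2 * u x ^ 4) + (m 1 * σ P 2 x - m 2 * σ P 1 x) / (2 * u x ^ 2),
        m 1 * η P x / (2 * u x ^ 4) + (m 2 * σ P 0 x - m 0 * σ P 2 x) / (2 * u x ^ 2),
        m 2 * η P x / (2 * u x ^ 4) + (m 0 * σ P 1 x - m 1 * σ P 0 x) / (2 * u x ^ 2)])
    (P M A : Fin 4) :
      (matPd P e x + e x * (antiSelfDual (b P)).transpose) M A -
        (matPd M e x + e x * (antiSelfDual (b M)).transpose) P A =
      (e x * spatialTorsion (4 * ρ / u x) A * (e x).transpose) P M := by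
  have hd0 : ∀ K L, matPd K e x L 0 =
      -(pd K (η L) x / (2 * u x)) + η L x * pd K u x / (2 * u x ^ 2) := by
    intro K L
    have h1 : HasDerivAt (fun r : ℝ => r⁻¹) (-(u x ^ 2)⁻¹) (u x) := hasDerivAt_inv hu0
    have : matPd K e x L 0 = pd K (fun y => (-1 / 2) * (η L y * (u y)⁻¹)) x := by
      simp only [matPd, Matrix.of_apply, he, monopoleFrame]
      congr 1
      funext y
      simp
      ring
    rw [this, pd_const_mul (f := fun y => η L y * (u y)⁻¹) _ ((hη L).mul (hu.inv hu0)),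
      pd_mul (k := fun y => (u y)⁻¹) (hη L) (hu.inv hu0),
      pd_comp h1 hu]
    field_simp
    ring
  have hdi : ∀ K L i, pd K (fun y => u y * σ L i y / 2) x =
      (pd K u x * σ L i x + u x * pd K (σ L i) x) / 2 := by
    intro K L i
    have : (fun y => u y * σ L i y / 2) = fun y => (1 / 2) * (u y * σ L i y) := by
      funext y; ring
    rw [this, pd_const_mul (f := fun y => u y * σ L i y) _ (hu.mul (hσ L i)), pd_mul hu (hσ L i)]
    ring
  have hd1 : ∀ K L, matPd K e x L 1 = (pd K u x * σ L 0 x + u x * pd K (σ L 0) x) / 2 :=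
    fun K L => by rw [← hdi]; simp [matPd, he, monopoleFrame]
  have hd2 : ∀ K L, matPd K e x L 2 = (pd K u x * σ L 1 x + u x * pd K (σ L 1) x) / 2 :=
    fun K L => by rw [← hdi]; simp [matPd, he, monopoleFrame]
  have hd3 : ∀ K L, matPd K e x L 3 = (pd K u x * σ L 2 x + u x * pd K (σ L 2) x) / 2 :=
    fun K L => by rw [← hdi]; simp [matPd, he, monopoleFrame]
  -- Once the derivatives of `u` are expressed through `m`, the derivatives of `η` and `σ` occur
  -- only antisymmetrized. Each component is then an algebraic identity modulo one structure
  -- equation.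
  have hx : e x = monopoleFrame (u x) (fun M => η M x) (fun M i => σ M i x) := by rw [he]
  simp only [Matrix.add_apply]
  fin_cases A
  · simp only [Fin.zero_eta, hd0, hdu, hx]
    simp [Matrix.mul_apply, Fin.sum_univ_four, Fin.sum_univ_three, monopoleFrame, antiSelfDual,
      spatialTorsion, hb]
    have := hdη P M
    linear_combination (norm := (field_simp; ring)) (-(1 / (2 * u x))) * this
  · simp only [Fin.mk_one, hd1, hdu, hx]
    simp [Matrix.mul_apply, Fin.sum_univ_four, Fin.sum_univ_three, monopoleFrame, antiSelfDual,
      spatialTorsion, hb]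
    have := hσ0 P M
    linear_combination (norm := (field_simp; ring)) (u x / 2) * this
  · simp only [Fin.reduceFinMk, hd2, hdu, hx]
    simp [Matrix.mul_apply, Fin.sum_univ_four, Fin.sum_univ_three, monopoleFrame, antiSelfDual,
      spatialTorsion, hb]
    have := hσ1 P M
    linear_combination (norm := (field_simp; ring)) (u x / 2) * this
  · simp only [Fin.reduceFinMk, hd3, hdu, hx]
    simp [Matrix.mul_apply, Fin.sum_univ_four, Fin.sum_univ_three, monopoleFrame, antiSelfDual,
      spatialTorsion, hb]
    have := hσ2 P M
    linear_combination (norm := (field_simp; ring)) (u x / 2) * this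

end Monopole

/-! ### Left-invariant forms of the 3-sphere in polar coordinates. -/

section DelducValentFrame

/-- The orthonormal frame `(∂_r, ∂_θ, ∂_φ)` of `ℝ³` in spherical coordinates. -/
noncomputable def sphereRot (x : Fin 4 → ℝ) : Matrix (Fin 3) (Fin 3) ℝ :=
  !![Real.sin (x 2) * Real.cos (x 3), Real.sin (x 2) * Real.sin (x 3), Real.cos (x 2);
    Real.cos (x 2) * Real.cos (x 3), Real.cos (x 2) * Real.sin (x 3), -Real.sin (x 2);
    -Real.sin (x 3), Real.cos (x 3), 0]

/-- The components of the left-invariant forms of the 3-sphere in the frame `sphereRot`. -/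
noncomputable def dvPolar (rho : ℝ) (x : Fin 4 → ℝ) : Matrix (Fin 4) (Fin 3) ℝ :=
  !![1 / (1 + rho ^ 2 * x 0 ^ 2), 0, 0;
    0, 0, 0;
    0, x 0 / (1 + rho ^ 2 * x 0 ^ 2), rho * x 0 ^ 2 / (1 + rho ^ 2 * x 0 ^ 2);
    0, -(rho * x 0 ^ 2 / (1 + rho ^ 2 * x 0 ^ 2) * Real.sin (x 2)),
      x 0 / (1 + rho ^ 2 * x 0 ^ 2) * Real.sin (x 2)]

/-- The left-invariant forms of the 3-sphere of radius `1 / ρ`. -/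
noncomputable def dvSphereForms (rho : ℝ) (x : Fin 4 → ℝ) : Matrix (Fin 4) (Fin 3) ℝ :=
  dvPolar rho x * sphereRot x

/-- An orthonormal frame of the Delduc-Valent metric. -/
noncomputable def dvFrame (lam rho : ℝ) (x : Fin 4 → ℝ) : Matrix (Fin 4) (Fin 4) ℝ :=
  monopoleFrame (Real.sqrt (dvV lam x)) (dvForm lam rho x) (dvSphereForms rho x)

lemma sphereRot_mul_transpose (x : Fin 4 → ℝ) : sphereRot x * (sphereRot x).transpose = 1 := by
  have h2 := Real.sin_sq_add_cos_sq (x 2)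
  have h3 := Real.sin_sq_add_cos_sq (x 3)
  ext i j
  fin_cases i <;> fin_cases j <;>
    simp [sphereRot, Matrix.mul_apply, Fin.sum_univ_three]
  · linear_combination Real.sin (x 2) ^ 2 * h3 + h2
  · linear_combination Real.sin (x 2) * Real.cos (x 2) * h3
  · ring
  · linear_combination Real.sin (x 2) * Real.cos (x 2) * h3
  · linear_combination Real.cos (x 2) ^ 2 * h3 + h2
  · ring
  · ring
  · ring
  · linear_combination h3

/-- The cross product of two rows of `sphereRot` is the third row. -/
lemma sphereRot_cross (x : Fin 4 → ℝ) (k : Fin 3) :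
    (∀ i, sphereRot x k (i + 1) * sphereRot x (k + 1) (i + 2) -
      sphereRot x k (i + 2) * sphereRot x (k + 1) (i + 1) = sphereRot x (k + 2) i) := by
  have h2 := Real.sin_sq_add_cos_sq (x 2)
  have h3 := Real.sin_sq_add_cos_sq (x 3)
  intro i
  obtain rfl | rfl | rfl : k = 0 ∨ k = 1 ∨ k = 2 := by omega
  all_goals obtain rfl | rfl | rfl : i = 0 ∨ i = 1 ∨ i = 2 := by omega
  all_goals simp [sphereRot]
  · linear_combination (-Real.sin (x 3)) * h2
  · linear_combination (Real.cos (x 3)) * h2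
  · ring
  · linear_combination (Real.cos (x 2)) * h3
  · ring
  · ring
  · linear_combination (-Real.sin (x 2)) * h3

lemma sphereRot_det (x : Fin 4 → ℝ) : (sphereRot x).det = 1 := by
  have h2 := Real.sin_sq_add_cos_sq (x 2)
  have h3 := Real.sin_sq_add_cos_sq (x 3)
  simp [Matrix.det_fin_three, sphereRot]
  linear_combination (Real.sin (x 2) ^ 2 + Real.cos (x 2) ^ 2) * h3 + h2

/-- Rotations commute with the cross product. The additions in `Fin 3` are cyclic, so `i + 1` and `i
+ 2` are the two indices complementary to `i`. -/
lemma dvSphereForms_cross (rho : ℝ) (x : Fin 4 → ℝ) (P M : Fin 4) (i : Fin 3) :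
    dvSphereForms rho x P (i + 1) * dvSphereForms rho x M (i + 2) -
      dvSphereForms rho x P (i + 2) * dvSphereForms rho x M (i + 1) =
    ∑ k, (dvPolar rho x P (k + 1) * dvPolar rho x M (k + 2) -
      dvPolar rho x P (k + 2) * dvPolar rho x M (k + 1)) * sphereRot x k i := by
  have c0 := sphereRot_cross x 0 i
  have c1 := sphereRot_cross x 1 i
  have c2 := sphereRot_cross x 2 i
  simp only [Fin.isValue, Fin.reduceAdd, zero_add] at c0 c1 c2
  simp only [dvSphereForms, Matrix.mul_apply, Fin.sum_univ_three, Fin.isValue, Fin.reduceAdd,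
    zero_add]
  generalize i + 1 = j at *
  generalize i + 2 = l at *
  rw [← c0, ← c1, ← c2]
  ring

lemma pd_fn_coord {M N : Fin 4} {φ : ℝ → ℝ} {φ' : ℝ} {x : Fin 4 → ℝ} (h : HasDerivAt φ φ' (x N)) :
    pd M (fun y => φ (y N)) x = if M = N then φ' else 0 := by
  rw [pd_comp h (by fun_prop), pd_coord]
  simp

lemma pd_fn_coord_mul {M N K : Fin 4} {φ ψ : ℝ → ℝ} {φ' ψ' : ℝ} {x : Fin 4 → ℝ}
    (h : HasDerivAt φ φ' (x N)) (h' : HasDerivAt ψ ψ' (x K)) :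
    pd M (fun y => φ (y N) * ψ (y K)) x =
      (if M = N then φ' else 0) * ψ (x K) + φ (x N) * if M = K then ψ' else 0 := by
  have d1 : DifferentiableAt ℝ (fun y : Fin 4 → ℝ => φ (y N)) x :=
    h.differentiableAt.comp x (by fun_prop)
  have d2 : DifferentiableAt ℝ (fun y : Fin 4 → ℝ => ψ (y K)) x :=
    h'.differentiableAt.comp x (by fun_prop)
  rw [pd_mul d1 d2, pd_fn_coord h, pd_fn_coord h']

/-- The angular velocity of `sphereRot` in the coordinate direction `P`. -/
noncomputable def sphereVelocity (x : Fin 4 → ℝ) : Fin 4 → Matrix (Fin 3) (Fin 3) ℝ := ![0, 0,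
  !![0, 1, 0; -1, 0, 0; 0, 0, 0],
  !![0, 0, Real.sin (x 2); 0, 0, Real.cos (x 2); -Real.sin (x 2), -Real.cos (x 2), 0]]

lemma matPd_sphereRot (x : Fin 4 → ℝ) (P : Fin 4) :
    matPd P sphereRot x = sphereVelocity x P * sphereRot x := by
  have s2 := Real.hasDerivAt_sin (x 2)
  have c2 := Real.hasDerivAt_cos (x 2)
  have s3 := Real.hasDerivAt_sin (x 3)
  have c3 := Real.hasDerivAt_cos (x 3)
  have h2 := Real.sin_sq_add_cos_sq (x 2)
  have p1 := pd_fn_coord_mul (M := P) s2 c3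
  have p2 := pd_fn_coord_mul (M := P) s2 s3
  have p3 := pd_fn_coord_mul (M := P) c2 c3
  have p4 := pd_fn_coord_mul (M := P) c2 s3
  have q1 := pd_fn_coord (M := P) s2
  have q2 := pd_fn_coord (M := P) c2
  have q3 := pd_fn_coord (M := P) s3
  have q4 := pd_fn_coord (M := P) c3
  have key : matPd P sphereRot x =
      !![pd P (fun y => Real.sin (y 2) * Real.cos (y 3)) x,
          pd P (fun y => Real.sin (y 2) * Real.sin (y 3)) x, pd P (fun y => Real.cos (y 2)) x;
        pd P (fun y => Real.cos (y 2) * Real.cos (y 3)) x,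
          pd P (fun y => Real.cos (y 2) * Real.sin (y 3)) x, -pd P (fun y => Real.sin (y 2)) x;
        -pd P (fun y => Real.sin (y 3)) x, pd P (fun y => Real.cos (y 3)) x, 0] := by
    ext i j
    fin_cases i <;> fin_cases j <;> simp [matPd, sphereRot, pd_neg, pd_const]
  rw [key, p1, p2, p3, p4, q1, q2, q3, q4]
  ext i j
  obtain rfl | rfl | rfl | rfl : P = 0 ∨ P = 1 ∨ P = 2 ∨ P = 3 := by omega
  all_goals fin_cases i <;> fin_cases j <;>
    simp [sphereVelocity, sphereRot, Matrix.mul_apply, Fin.sum_univ_three]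
  · linear_combination Real.cos (x 3) * h2
  · linear_combination Real.sin (x 3) * h2
  · ring

/-- The derivatives of `dvPolar`. -/
noncomputable def dvPolarDeriv (rho : ℝ) (x : Fin 4 → ℝ) (P : Fin 4) : Matrix (Fin 4) (Fin 3) ℝ :=
  let a' := if P = 0 then -2 * rho ^ 2 * x 0 / (1 + rho ^ 2 * x 0 ^ 2) ^ 2 else 0
  let b' := if P = 0 then (1 - rho ^ 2 * x 0 ^ 2) / (1 + rho ^ 2 * x 0 ^ 2) ^ 2 else 0
  let d' := if P = 0 then 2 * rho * x 0 / (1 + rho ^ 2 * x 0 ^ 2) ^ 2 else 0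
  let c' := if P = 2 then Real.cos (x 2) else 0
  !![a', 0, 0;
    0, 0, 0;
    0, b', d';
    0, -(d' * Real.sin (x 2) + rho * x 0 ^ 2 / (1 + rho ^ 2 * x 0 ^ 2) * c'),
      b' * Real.sin (x 2) + x 0 / (1 + rho ^ 2 * x 0 ^ 2) * c']

lemma one_add_sq_pos (rho s : ℝ) : 0 < 1 + rho ^ 2 * s ^ 2 := by positivity

lemma matPd_dvPolar (rho : ℝ) (x : Fin 4 → ℝ) (P : Fin 4) :
    matPd P (dvPolar rho) x = dvPolarDeriv rho x P := by
  have h0 := (one_add_sq_pos rho (x 0)).ne'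
  have hh : HasDerivAt (fun s : ℝ => 1 + rho ^ 2 * s ^ 2) (rho ^ 2 * (2 * x 0)) (x 0) := by
    simpa using ((hasDerivAt_pow 2 (x 0)).const_mul (rho ^ 2)).const_add 1
  have ha : HasDerivAt (fun s : ℝ => 1 / (1 + rho ^ 2 * s ^ 2))
      (-2 * rho ^ 2 * x 0 / (1 + rho ^ 2 * x 0 ^ 2) ^ 2) (x 0) := by
    exact ((hasDerivAt_const (x 0) (1 : ℝ)).fun_div hh h0).congr_deriv (by ring)
  have hb : HasDerivAt (fun s : ℝ => s / (1 + rho ^ 2 * s ^ 2))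
      ((1 - rho ^ 2 * x 0 ^ 2) / (1 + rho ^ 2 * x 0 ^ 2) ^ 2) (x 0) := by
    exact ((hasDerivAt_id' (x 0)).fun_div hh h0).congr_deriv (by ring)
  have hd : HasDerivAt (fun s : ℝ => rho * s ^ 2 / (1 + rho ^ 2 * s ^ 2))
      (2 * rho * x 0 / (1 + rho ^ 2 * x 0 ^ 2) ^ 2) (x 0) := by
    have hsq : HasDerivAt (fun s : ℝ => rho * s ^ 2) (rho * (2 * x 0)) (x 0) := by
      simpa using (hasDerivAt_pow 2 (x 0)).const_mul rho
    exact (hsq.fun_div hh h0).congr_deriv (by ring)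
  have s2 := Real.hasDerivAt_sin (x 2)
  have q1 := pd_fn_coord (M := P) ha
  have q2 := pd_fn_coord (M := P) hb
  have q3 := pd_fn_coord (M := P) hd
  have p1 := pd_fn_coord_mul (M := P) hd s2
  have p2 := pd_fn_coord_mul (M := P) hb s2
  have key : matPd P (dvPolar rho) x =
      !![pd P (fun y => 1 / (1 + rho ^ 2 * y 0 ^ 2)) x, 0, 0;
        0, 0, 0;
        0, pd P (fun y => y 0 / (1 + rho ^ 2 * y 0 ^ 2)) x,
          pd P (fun y => rho * y 0 ^ 2 / (1 + rho ^ 2 * y 0 ^ 2)) x;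
        0, -pd P (fun y => rho * y 0 ^ 2 / (1 + rho ^ 2 * y 0 ^ 2) * Real.sin (y 2)) x,
          pd P (fun y => y 0 / (1 + rho ^ 2 * y 0 ^ 2) * Real.sin (y 2)) x] := by
    ext i j
    fin_cases i <;> fin_cases j <;> simp [matPd, dvPolar, pd_neg, pd_const]
  rw [key, q1, q2, q3, p1, p2]
  rfl

/-- The Maurer–Cartan equation `dσ = ρ σ × σ` written in the rotating frame `sphereRot`, whose
angular velocity supplies the extra term. With `s = tan χ / ρ`, the angular forms are the polar ones
turned by the angle `χ`. -/
lemma dvPolar_structure (rho : ℝ) (x : Fin 4 → ℝ) (P M : Fin 4) (k : Fin 3) :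
    (dvPolarDeriv rho x P + dvPolar rho x * sphereVelocity x P) M k -
      (dvPolarDeriv rho x M + dvPolar rho x * sphereVelocity x M) P k =
    2 * rho * (dvPolar rho x P (k + 1) * dvPolar rho x M (k + 2) -
      dvPolar rho x P (k + 2) * dvPolar rho x M (k + 1)) := by
  have h0 := (one_add_sq_pos rho (x 0)).ne'
  obtain rfl | rfl | rfl : k = 0 ∨ k = 1 ∨ k = 2 := by omega
  all_goals fin_cases P <;> fin_cases M <;>
    simp [dvPolarDeriv, dvPolar, sphereVelocity] <;> field_simp <;> ring_nf <;> simp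

end DelducValentFrame

/-! ### The Delduc–Valent metric is HKT. -/

section DelducValentHKT

lemma contDiff_dvPolar (rho : ℝ) (M : Fin 4) (j : Fin 3) :
    ContDiff ℝ ∞ (fun y => dvPolar rho y M j) := by
  have h1 : ContDiff ℝ ∞ fun y : Fin 4 → ℝ => 1 + rho ^ 2 * y 0 ^ 2 := by fun_prop
  have h0 : ∀ y : Fin 4 → ℝ, 1 + rho ^ 2 * y 0 ^ 2 ≠ 0 := fun y => (one_add_sq_pos rho (y 0)).ne'
  have ha : ContDiff ℝ ∞ fun y : Fin 4 → ℝ => 1 / (1 + rho ^ 2 * y 0 ^ 2) :=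
    contDiff_const.div h1 h0
  have hb : ContDiff ℝ ∞ fun y : Fin 4 → ℝ => y 0 / (1 + rho ^ 2 * y 0 ^ 2) :=
    ContDiff.div (by fun_prop) h1 h0
  have hd : ContDiff ℝ ∞ fun y : Fin 4 → ℝ => rho * y 0 ^ 2 / (1 + rho ^ 2 * y 0 ^ 2) :=
    ContDiff.div (by fun_prop) h1 h0
  have hs : ContDiff ℝ ∞ fun y : Fin 4 → ℝ => Real.sin (y 2) := by fun_prop
  have hz : ContDiff ℝ ∞ fun _ : Fin 4 → ℝ => (0 : ℝ) := contDiff_const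
  fin_cases M <;> fin_cases j
  exacts [ha, hz, hz, hz, hz, hz, hz, hb, hd, hz, (hd.mul hs).neg, hb.mul hs]

lemma contDiff_sphereRot (i j : Fin 3) : ContDiff ℝ ∞ (fun y => sphereRot y i j) := by
  fin_cases i <;> fin_cases j <;> simp [sphereRot] <;> fun_prop

lemma contDiff_dvSphereForms (rho : ℝ) (M : Fin 4) (j : Fin 3) :
    ContDiff ℝ ∞ (fun y => dvSphereForms rho y M j) := by
  simp only [dvSphereForms, Matrix.mul_apply]
  exact ContDiff.sum fun k _ => (contDiff_dvPolar rho M k).mul (contDiff_sphereRot k j)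

lemma contDiff_dvForm (lam rho : ℝ) (M : Fin 4) : ContDiff ℝ ∞ (fun y => dvForm lam rho y M) := by
  have h1 : ContDiff ℝ ∞ fun y : Fin 4 → ℝ => 1 + rho ^ 2 * y 0 ^ 2 := by fun_prop
  have h0 : ∀ y : Fin 4 → ℝ, 1 + rho ^ 2 * y 0 ^ 2 ≠ 0 := fun y => (one_add_sq_pos rho (y 0)).ne'
  fin_cases M
  · exact (ContDiff.div (f := fun y : Fin 4 → ℝ => rho * (1 + lam * y 0)) (by fun_prop) h1 h0).neg
  · exact contDiff_const
  · exact contDiff_const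
  · change ContDiff ℝ ∞ fun y : Fin 4 → ℝ => Real.cos (y 2)
    fun_prop

lemma contDiffOn_dvV (lam : ℝ) : ContDiffOn ℝ ∞ (dvV lam) (dvDomain lam) := by
  refine ContDiffOn.add (ContDiffOn.div contDiffOn_const ?_ fun x hx => hx.1.ne') contDiffOn_const
  exact ContDiff.contDiffOn (by fun_prop)

lemma isOpen_dvDomain (lam : ℝ) : IsOpen (dvDomain lam) := by
  have : dvDomain lam = {x | 0 < x 0} ∩ {x | 0 < 1 + lam * x 0} ∩ {x | 0 < x 2} ∩
      {x | x 2 < Real.pi} := by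
    ext x
    constructor
    · intro hx
      exact ⟨⟨⟨hx.1, one_add_mul_pos_of_mem hx⟩, hx.2.2.1⟩, hx.2.2.2⟩
    · rintro ⟨⟨⟨h1, h2⟩, h3⟩, h4⟩
      refine ⟨h1, ?_, h3, h4⟩
      have h1' : x 0 ≠ 0 := ne_of_gt h1
      have : 1 / x 0 + lam = (1 + lam * x 0) / x 0 := by field_simp
      rw [this]
      exact div_pos h2 h1
  rw [this]
  refine ((IsOpen.inter ?_ ?_).inter ?_).inter ?_
  · exact isOpen_lt continuous_const (by fun_prop)
  · exact isOpen_lt continuous_const (by fun_prop)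
  · exact isOpen_lt continuous_const (by fun_prop)
  · exact isOpen_lt (by fun_prop) continuous_const

lemma smoothOn_dvFrame (lam rho : ℝ) : SmoothOn (dvDomain lam) (dvFrame lam rho) := by
  have hu : ContDiffOn ℝ ∞ (fun y => Real.sqrt (dvV lam y)) (dvDomain lam) :=
    (contDiffOn_dvV lam).sqrt fun x hx => hx.2.1.ne'
  have hη := fun M => (contDiff_dvForm lam rho M).contDiffOn (s := dvDomain lam)
  have hσ := fun M i => (contDiff_dvSphereForms rho M i).contDiffOn (s := dvDomain lam)
  intro M A
  have hu2 : ∀ i, ContDiffOn ℝ ∞ (fun y => Real.sqrt (dvV lam y) * dvSphereForms rho y M i / 2)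
      (dvDomain lam) := fun i => (hu.mul (hσ M i)).div_const 2
  fin_cases A
  · exact ((hη M).div (contDiffOn_const.mul hu) fun x hx =>
      mul_ne_zero two_ne_zero (Real.sqrt_pos.mpr hx.2.1).ne').neg
  · exact hu2 0
  · exact hu2 1
  · exact hu2 2

lemma dvSphereForms_mul_transpose (rho : ℝ) (x : Fin 4 → ℝ) :
    dvSphereForms rho x * (dvSphereForms rho x).transpose = dvGamma rho x := by
  have h1 : dvSphereForms rho x * (dvSphereForms rho x).transpose =
      dvPolar rho x * (dvPolar rho x).transpose := by
    rw [dvSphereForms, Matrix.transpose_mul, Matrix.mul_assoc, ← Matrix.mul_assoc (sphereRot x),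
      sphereRot_mul_transpose, Matrix.one_mul]
  have h0 := (one_add_sq_pos rho (x 0)).ne'
  rw [h1]
  ext i j
  fin_cases i <;> fin_cases j <;>
    simp [dvPolar, dvGamma, Matrix.mul_apply, Fin.sum_univ_three] <;> field_simp <;> ring

lemma dvFrame_mul_transpose {lam : ℝ} (rho : ℝ) {x : Fin 4 → ℝ} (hx : x ∈ dvDomain lam) :
    dvFrame lam rho x * (dvFrame lam rho x).transpose = dvMetric lam rho x := by
  have hV : 0 < dvV lam x := hx.2.1
  have hu := Real.sqrt_pos.mpr hV
  have hu2 := Real.sq_sqrt hV.le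
  ext M N
  have h1 := congrFun (congrFun (dvSphereForms_mul_transpose rho x) M) N
  simp only [Matrix.mul_apply, Matrix.transpose_apply, Fin.sum_univ_three] at h1
  simp only [Matrix.mul_apply, Matrix.transpose_apply, Fin.sum_univ_four, dvMetric,
    Matrix.smul_apply, Matrix.add_apply, Matrix.vecMulVec_apply, ← h1, smul_eq_mul]
  simp [dvFrame, monopoleFrame]
  rw [← hu2]
  have := hu.ne'
  simp only [Real.sqrt_sq hu.le]
  field_simp
  ring

lemma isMetric_dvMetric (lam rho : ℝ) : IsMetric (dvDomain lam) (dvMetric lam rho) := by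
  refine ⟨isOpen_dvDomain lam, fun M N => ?_, fun x hx => ?_⟩
  · have h : SmoothOn (dvDomain lam) fun x => dvFrame lam rho x * (dvFrame lam rho x).transpose :=
      SmoothOn.mul (B := fun x => (dvFrame lam rho x).transpose) (smoothOn_dvFrame lam rho)
        fun a b => smoothOn_dvFrame lam rho b a
    exact (h M N).congr fun x hx => congrFun (congrFun (dvFrame_mul_transpose rho hx).symm M) N
  · have hV : 0 < dvV lam x := hx.2.1
    have h0 := one_add_sq_pos rho (x 0)
    have hs := sin_pos_of_mem hx
    have hx0 := hx.1
    refine Matrix.PosDef.of_dotProduct_mulVec_pos ?_ fun v hv => ?_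
    · rw [← dvFrame_mul_transpose rho hx]
      simpa using Matrix.isHermitian_mul_conjTranspose_self (dvFrame lam rho x)
    -- A positive combination of squares: the terms from `Γ` control every component but `v 1`,
    -- which the square of `dΨ + ω` controls when the others vanish.
    · have hq : star v ⬝ᵥ (dvMetric lam rho x).mulVec v =
          (1 / 4) * ((dvV lam x)⁻¹ * (∑ M, dvForm lam rho x M * v M) ^ 2 +
            dvV lam x * (1 / (1 + rho ^ 2 * x 0 ^ 2) ^ 2 * v 0 ^ 2 +
              x 0 ^ 2 / (1 + rho ^ 2 * x 0 ^ 2) * v 2 ^ 2 +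
              x 0 ^ 2 / (1 + rho ^ 2 * x 0 ^ 2) * Real.sin (x 2) ^ 2 * v 3 ^ 2)) := by
        simp [dotProduct, Matrix.mulVec, Fin.sum_univ_four, dvMetric, dvGamma,
          Matrix.vecMulVec_apply]
        ring
      rw [hq]
      by_cases h023 : v 0 = 0 ∧ v 2 = 0 ∧ v 3 = 0
      · obtain ⟨v0, v2, v3⟩ := h023
        have v1 : v 1 ≠ 0 := fun v1 => hv (funext fun i => by fin_cases i <;> assumption)
        simp only [Fin.sum_univ_four, v0, v2, v3, mul_zero, add_zero, zero_add,
          show dvForm lam rho x 1 = 1 from rfl, one_mul]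
        positivity
      · have hpos : 0 < 1 / (1 + rho ^ 2 * x 0 ^ 2) ^ 2 * v 0 ^ 2 +
            x 0 ^ 2 / (1 + rho ^ 2 * x 0 ^ 2) * v 2 ^ 2 +
            x 0 ^ 2 / (1 + rho ^ 2 * x 0 ^ 2) * Real.sin (x 2) ^ 2 * v 3 ^ 2 := by
          by_cases v0 : v 0 = 0
          · by_cases v2 : v 2 = 0
            · have v3 : v 3 ≠ 0 := fun v3 => h023 ⟨v0, v2, v3⟩
              positivity
            · positivity
          · positivity
        positivity

lemma dvSphereForms_structure (rho : ℝ) (x : Fin 4 → ℝ) (P M : Fin 4) (i : Fin 3) :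
    pd P (fun y => dvSphereForms rho y M i) x - pd M (fun y => dvSphereForms rho y P i) x =
      2 * rho * (dvSphereForms rho x P (i + 1) * dvSphereForms rho x M (i + 2) -
        dvSphereForms rho x P (i + 2) * dvSphereForms rho x M (i + 1)) := by
  have hd : ∀ K, matPd K (dvSphereForms rho) x =
      (dvPolarDeriv rho x K + dvPolar rho x * sphereVelocity x K) * sphereRot x := by
    intro K
    have h := matPd_mul (A := dvPolar rho) (B := sphereRot) (x := x) K
      (fun a b => ((contDiff_dvPolar rho a b).differentiable (by simp)).differentiableAt)
      (fun a b => ((contDiff_sphereRot a b).differentiable (by simp)).differentiableAt)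
    rw [matPd_dvPolar, matPd_sphereRot, ← Matrix.mul_assoc, ← Matrix.add_mul] at h
    exact h
  have hd' : ∀ K L, pd K (fun y => dvSphereForms rho y L i) x =
      ∑ k, (dvPolarDeriv rho x K + dvPolar rho x * sphereVelocity x K) L k * sphereRot x k i := by
    intro K L
    rw [← Matrix.mul_apply, ← hd]
    rfl
  rw [hd', hd', dvSphereForms_cross, ← Finset.sum_sub_distrib, Finset.mul_sum]
  refine Finset.sum_congr rfl fun k _ => ?_
  rw [← sub_mul, dvPolar_structure]
  ring

/-- Row 0 of `sphereRot` is the radial direction, the direction of `dV`; this lemma and the next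
turn `m·σ` and `m·(σ × σ)` into polar components. -/
lemma dvSphereForms_radial (rho : ℝ) (x : Fin 4 → ℝ) (P : Fin 4) :
    ∑ i, sphereRot x 0 i * dvSphereForms rho x P i = dvPolar rho x P 0 := by
  have h : dvSphereForms rho x * (sphereRot x).transpose = dvPolar rho x := by
    rw [dvSphereForms, Matrix.mul_assoc, sphereRot_mul_transpose, Matrix.mul_one]
  rw [← congrFun (congrFun h P) 0, Matrix.mul_apply]
  exact Finset.sum_congr rfl fun i _ => by rw [Matrix.transpose_apply, mul_comm]

lemma dvSphereForms_radial_cross (rho : ℝ) (x : Fin 4 → ℝ) (P M : Fin 4) :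
    ∑ i, sphereRot x 0 i * (dvSphereForms rho x P (i + 1) * dvSphereForms rho x M (i + 2) -
      dvSphereForms rho x P (i + 2) * dvSphereForms rho x M (i + 1)) =
    dvPolar rho x P 1 * dvPolar rho x M 2 - dvPolar rho x P 2 * dvPolar rho x M 1 := by
  have h : ∀ k, ∑ i, sphereRot x 0 i * sphereRot x k i = (1 : Matrix (Fin 3) (Fin 3) ℝ) 0 k := by
    intro k
    rw [← sphereRot_mul_transpose x, Matrix.mul_apply]
    rfl
  simp only [dvSphereForms_cross, Finset.mul_sum]
  rw [Finset.sum_comm]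
  have h' : ∀ k, ∑ i, sphereRot x 0 i * ((dvPolar rho x P (k + 1) * dvPolar rho x M (k + 2) -
      dvPolar rho x P (k + 2) * dvPolar rho x M (k + 1)) * sphereRot x k i) =
      (dvPolar rho x P (k + 1) * dvPolar rho x M (k + 2) -
      dvPolar rho x P (k + 2) * dvPolar rho x M (k + 1)) *
        (1 : Matrix (Fin 3) (Fin 3) ℝ) 0 k := by
    intro k
    rw [← h, Finset.mul_sum]
    exact Finset.sum_congr rfl fun i _ => by ring
  simp only [h', Matrix.one_apply]
  simp

lemma pd_sqrt_dvV {lam : ℝ} (rho : ℝ) {x : Fin 4 → ℝ} (hx : x ∈ dvDomain lam) (P : Fin 4) :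
    pd P (fun y => Real.sqrt (dvV lam y)) x =
      -((1 + rho ^ 2 * x 0 ^ 2) / x 0 ^ 2 * dvPolar rho x P 0) / (2 * Real.sqrt (dvV lam x)) := by
  have h0 := (one_add_sq_pos rho (x 0)).ne'
  have hx0 : x 0 ≠ 0 := hx.1.ne'
  have hu : Real.sqrt (dvV lam x) ≠ 0 := (Real.sqrt_pos.mpr hx.2.1).ne'
  have h1 : HasDerivAt (fun s : ℝ => 1 / s + lam) (-(x 0 ^ 2)⁻¹) (x 0) := by
    simpa [one_div] using (hasDerivAt_inv hx0).add_const lam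
  have h2 := pd_fn_coord (M := P) (h1.sqrt hx.2.1.ne')
  rw [show (fun y => Real.sqrt (dvV lam y)) = fun y => Real.sqrt (1 / y 0 + lam) from rfl, h2]
  change (if P = 0 then -(x 0 ^ 2)⁻¹ / (2 * Real.sqrt (dvV lam x)) else 0) = _
  fin_cases P <;> simp [dvPolar]
  field_simp

lemma dvForm_structure {lam : ℝ} (rho : ℝ) {x : Fin 4 → ℝ} (hx : x ∈ dvDomain lam) (P M : Fin 4) :
    pd P (fun y => dvForm lam rho y M) x - pd M (fun y => dvForm lam rho y P) x =
      -((1 + rho ^ 2 * x 0 ^ 2) / x 0 ^ 2 *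
        (dvPolar rho x P 1 * dvPolar rho x M 2 - dvPolar rho x P 2 * dvPolar rho x M 1)) := by
  have h0 := (one_add_sq_pos rho (x 0)).ne'
  have hx0 : x 0 ≠ 0 := hx.1.ne'
  -- The value of this derivative is immaterial: the `ds` coefficient depends on `s` alone, so that
  -- term of `ω` is closed.
  have hw : ∃ w, HasDerivAt (fun s : ℝ => -(rho * (1 + lam * s) / (1 + rho ^ 2 * s ^ 2))) w (x 0) :=
    ⟨_, DifferentiableAt.hasDerivAt (by fun_prop (disch := exact h0))⟩
  obtain ⟨w, hw⟩ := hw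
  have d0 : ∀ K, pd K (fun y => dvForm lam rho y 0) x = if K = 0 then w else 0 :=
    fun K => pd_fn_coord (M := K) hw
  have d1 : ∀ K, pd K (fun y => dvForm lam rho y 1) x = 0 := fun K => pd_const K x 1
  have d2 : ∀ K, pd K (fun y => dvForm lam rho y 2) x = 0 := fun K => pd_const K x 0
  have d3 : ∀ K, pd K (fun y => dvForm lam rho y 3) x = if K = 2 then -Real.sin (x 2) else 0 :=
    fun K => pd_fn_coord (M := K) (Real.hasDerivAt_cos (x 2))
  obtain rfl | rfl | rfl | rfl : P = 0 ∨ P = 1 ∨ P = 2 ∨ P = 3 := by omega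
  all_goals obtain rfl | rfl | rfl | rfl : M = 0 ∨ M = 1 ∨ M = 2 ∨ M = 3 := by omega
  all_goals simp [d0, d1, d2, d3, dvPolar]
  all_goals field_simp
  all_goals ring_nf
  all_goals simp

/-- The torsion is `ρ V σ¹ ∧ σ² ∧ σ³`. The `Ψ` row of `dvPolar` is zero, so the rows `S, P, M` are
obtained from the rows `s, θ, φ` by a selection matrix, and determinants multiply. -/
lemma dvTorsion_eq {lam : ℝ} (rho : ℝ) {x : Fin 4 → ℝ} (hx : x ∈ dvDomain lam) (S P M : Fin 4) :
    dvTorsion lam rho x S P M = rho * dvV lam x * Matrix.det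
      (Matrix.of fun i => dvSphereForms rho x ((![S, P, M] : Fin 3 → Fin 4) i)) := by
  have h0 := (one_add_sq_pos rho (x 0)).ne'
  have hx0 : x 0 ≠ 0 := hx.1.ne'
  have h1 : (Matrix.of fun i => dvSphereForms rho x ((![S, P, M] : Fin 3 → Fin 4) i)) =
      (Matrix.of fun i j : Fin 3 =>
        if (![S, P, M] : Fin 3 → Fin 4) i = (![0, 2, 3] : Fin 3 → Fin 4) j then (1 : ℝ) else 0) *
      (Matrix.of fun i => dvPolar rho x ((![0, 2, 3] : Fin 3 → Fin 4) i)) * sphereRot x := by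
    ext i j
    rw [Matrix.of_apply, dvSphereForms, Matrix.mul_apply, Matrix.mul_apply]
    refine Finset.sum_congr rfl fun k _ => ?_
    congr 1
    simp only [Matrix.mul_apply, Matrix.of_apply, Fin.sum_univ_three]
    generalize (![S, P, M] : Fin 3 → Fin 4) i = K
    obtain rfl | rfl | rfl | rfl : K = 0 ∨ K = 1 ∨ K = 2 ∨ K = 3 := by omega
    all_goals fin_cases k <;> simp [dvPolar]
  have h2 : Matrix.det (Matrix.of fun i => dvPolar rho x ((![0, 2, 3] : Fin 3 → Fin 4) i)) =
      x 0 ^ 2 / (1 + rho ^ 2 * x 0 ^ 2) ^ 2 * Real.sin (x 2) := by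
    simp [Matrix.det_fin_three, dvPolar]
    field_simp
  rw [h1, Matrix.det_mul, Matrix.det_mul, h2, sphereRot_det, dvTorsion, dvV]
  field_simp

lemma dvTorsion_antisymm (lam rho : ℝ) (x : Fin 4 → ℝ) (S P M : Fin 4) :
    dvTorsion lam rho x P S M = -dvTorsion lam rho x S P M ∧
      dvTorsion lam rho x S M P = -dvTorsion lam rho x S P M := by
  -- With the Kronecker deltas made opaque, the antisymmetry is a polynomial identity and needs no
  -- case split.
  obtain ⟨δ, hδ⟩ : ∃ δ : Fin 4 → Fin 4 → ℝ, ∀ a b, (if a = b then (1 : ℝ) else 0) = δ a b :=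
    ⟨_, fun _ _ => rfl⟩
  simp only [dvTorsion, hδ, Matrix.det_fin_three, Matrix.of_apply, Matrix.cons_val]
  constructor <;> ring

/-- The Delduc-Valent metric is HKT. -/
theorem exists_isHKTWithTorsion_dvMetric (lam rho : ℝ) :
    ∃ I : Fin 3 → (Fin 4 → ℝ) → Matrix (Fin 4) (Fin 4) ℝ,
      IsHKTWithTorsion (dvDomain lam) (dvMetric lam rho) I
        (fun x S P M => (1 / 2) * dvTorsion lam rho x S P M) := by
  -- The components of `-dV = ds / s²` in the coframe `σ`, whose radial form is `ds / (1 + ρ² s²)`.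
  let m : (Fin 4 → ℝ) → Fin 3 → ℝ := fun x i =>
    (1 + rho ^ 2 * x 0 ^ 2) / x 0 ^ 2 * sphereRot x 0 i
  let u : (Fin 4 → ℝ) → ℝ := fun x => Real.sqrt (dvV lam x)
  let σ : Fin 4 → Fin 3 → (Fin 4 → ℝ) → ℝ := fun M i x => dvSphereForms rho x M i
  -- Since `e¹ ∧ e² ∧ e³ = (u³ / 8) σ¹ ∧ σ² ∧ σ³` and `V = u²`, the value `t = 4 ρ / u` gives
  -- exactly half of `ρ V σ¹ ∧ σ² ∧ σ³`. The coefficients `b` are those of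
  -- `monopoleFrame_structure`.
  refine ⟨_, isHKTWithTorsion_of_frame (isMetric_dvMetric lam rho) (smoothOn_dvFrame lam rho)
    (fun x hx => dvFrame_mul_transpose rho hx) (fun S P M => ?_)
    (fun x _ S P M => ?_) (fun x _ S P M => ?_) (t := fun x => 4 * rho / u x)
    (b := fun x P =>
      ![m x 0 * dvForm lam rho x P / (2 * u x ^ 4) +
          (m x 1 * σ P 2 x - m x 2 * σ P 1 x) / (2 * u x ^ 2),
        m x 1 * dvForm lam rho x P / (2 * u x ^ 4) +
          (m x 2 * σ P 0 x - m x 0 * σ P 2 x) / (2 * u x ^ 2),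
        m x 2 * dvForm lam rho x P / (2 * u x ^ 4) +
          (m x 0 * σ P 1 x - m x 1 * σ P 0 x) / (2 * u x ^ 2)])
    (fun x hx P M A => ?_) (fun x hx S P M => ?_)⟩
  · have h1 : ContDiff ℝ ∞ fun y : Fin 4 → ℝ => (1 + rho ^ 2 * y 0 ^ 2) ^ 2 := by fun_prop
    have h2 : ContDiff ℝ ∞ fun y : Fin 4 → ℝ => rho * y 0 * (1 + lam * y 0) := by fun_prop
    have h3 : ContDiff ℝ ∞ fun y : Fin 4 → ℝ => Real.sin (y 2) := by fun_prop
    exact (contDiff_const.mul (((h2.div h1 fun y =>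
      pow_ne_zero 2 (one_add_sq_pos rho (y 0)).ne').mul h3).mul contDiff_const)).contDiffOn
  · rw [(dvTorsion_antisymm lam rho x S P M).1, mul_neg]
  · rw [(dvTorsion_antisymm lam rho x S P M).2, mul_neg]
  · have hu0 : u x ≠ 0 := (Real.sqrt_pos.mpr hx.2.1).ne'
    refine monopoleFrame_structure (u := u) (η := fun M y => dvForm lam rho y M) (σ := σ)
      (m := m x) ?_
      (fun M => ((contDiff_dvForm lam rho M).differentiable (by simp)).differentiableAt)
      (fun M i => ((contDiff_dvSphereForms rho M i).differentiable (by simp)).differentiableAt)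
      hu0 (fun P => ?_) (fun P M => ?_) (fun P M => dvSphereForms_structure rho x P M 0)
      (fun P M => dvSphereForms_structure rho x P M 1)
      (fun P M => dvSphereForms_structure rho x P M 2) rfl rfl P M A
    · exact differentiableAt_of_contDiffOn (isOpen_dvDomain lam) hx
        ((contDiffOn_dvV lam).sqrt fun x hx => hx.2.1.ne')
    · rw [pd_sqrt_dvV rho hx, ← dvSphereForms_radial]
      simp only [m, σ, u, Finset.mul_sum, mul_assoc]
    · rw [dvForm_structure rho hx, ← dvSphereForms_radial_cross, Fin.sum_univ_three]
      simp only [Fin.isValue, Fin.reduceAdd, zero_add, m, σ]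
      ring
  · have hV : 0 < dvV lam x := hx.2.1
    have hu0 : u x ≠ 0 := (Real.sqrt_pos.mpr hV).ne'
    have hu2 : dvV lam x = u x ^ 2 := (Real.sq_sqrt hV.le).symm
    rw [dvTorsion_eq rho hx, hu2]
    simp [Matrix.det_fin_three, dvFrame, monopoleFrame, spatialTorsion, Matrix.mul_apply,
      Fin.sum_univ_four, show Real.sqrt (dvV lam x) = u x from rfl]
    field_simp
    ring

end DelducValentHKT

/-! ### Irreducibility and the main theorem. -/

lemma isIrreducibleHKT_dvMetric {lam rho c : ℝ} (hrho : rho ≠ 0) (hc : c ≠ 0)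
    {U : Set (Fin 4 → ℝ)} {I : Fin 3 → (Fin 4 → ℝ) → Matrix (Fin 4) (Fin 4) ℝ} (hne : U.Nonempty)
    (hU : U ⊆ dvDomain lam)
    (h : IsHKTWithTorsion U (dvMetric lam rho) I (fun x S P M => c * dvTorsion lam rho x S P M)) :
    IsIrreducibleHKT 1 U (dvMetric lam rho) I := by
  refine ⟨by simp, ⟨_, h⟩, ?_⟩
  rintro ⟨g', I', hk, hrel⟩
  exact not_exists_conformal_factor hrho hc hne hU h
    (hrel.exists_conformal_factor h.hyperHermitian.metric hk)

lemma dvDomain_zero_nonempty : (dvDomain 0).Nonempty :=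
  ⟨fun _ => 1, by norm_num [dvDomain]; linarith [Real.pi_gt_three]⟩

end HKT

theorem theorem10 :
    -- irreducible HKT metrics exist
    (∃ (n : ℕ) (U : Set (Fin (4 * n) → ℝ)) (g : (Fin (4 * n) → ℝ) → Matrix (Fin (4 * n)) (Fin (4 * n)) ℝ)
      (I : Fin 3 → (Fin (4 * n) → ℝ) → Matrix (Fin (4 * n)) (Fin (4 * n)) ℝ),
      U.Nonempty ∧ HKT.IsIrreducibleHKT n U g I) ∧
    -- namely, every Delduc-Valent metric with nonzero `rho`
    ∀ lam rho : ℝ, rho ≠ 0 →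
      -- it is HKT
      (∃ I : Fin 3 → (Fin 4 → ℝ) → Matrix (Fin 4) (Fin 4) ℝ,
        HKT.IsHKTWithTorsion (HKT.dvDomain lam) (HKT.dvMetric lam rho) I
          (fun x S P M => (1 / 2) * HKT.dvTorsion lam rho x S P M)) ∧
      -- its complex structures, which are parallel for the Bismut connection with
      -- this torsion (in any normalization), cannot be made Levi-Civita parallel, even locally
      ∀ (c : ℝ) (U : Set (Fin 4 → ℝ)) (I : Fin 3 → (Fin 4 → ℝ) → Matrix (Fin 4) (Fin 4) ℝ),
        c ≠ 0 → U.Nonempty → U ⊆ HKT.dvDomain lam →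
        HKT.IsHKTWithTorsion U (HKT.dvMetric lam rho) I
          (fun x S P M => c * HKT.dvTorsion lam rho x S P M) →
        HKT.IsIrreducibleHKT 1 U (HKT.dvMetric lam rho) I ∧
        ¬ ∃ G : (Fin 4 → ℝ) → ℝ, ContDiffOn ℝ ∞ G U ∧ (∀ x ∈ U, 0 < G x) ∧
          ∀ p, HKT.IsParallel U (HKT.leviCivita fun x => G x • HKT.dvMetric lam rho x) (I p) := by
  refine ⟨?_, fun lam rho hrho => ⟨HKT.exists_isHKTWithTorsion_dvMetric lam rho, ?_⟩⟩
  -- The instance `λ = 0`, `ρ = 1` serves as the example; its torsion constant is `c = 1/2`.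
  · obtain ⟨I, hI⟩ := HKT.exists_isHKTWithTorsion_dvMetric 0 1
    exact ⟨1, HKT.dvDomain 0, HKT.dvMetric 0 1, I, HKT.dvDomain_zero_nonempty,
      HKT.isIrreducibleHKT_dvMetric one_ne_zero (by norm_num) HKT.dvDomain_zero_nonempty
        subset_rfl hI⟩
  · intro c U I hc hne hU h
    exact ⟨HKT.isIrreducibleHKT_dvMetric hrho hc hne hU h,
      HKT.not_exists_conformal_factor hrho hc hne hU h⟩
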